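/- **Setting.** Let $n_p,n_c,n_u\in\mathbb N_0$, $n=n_p+n_c$, let $\dot x_p=f_p(x_p,\hat u)$ be a plant with state in $\mathbb R^{n_p}$, and let $\dot x_c=f_c(x_c,\hat x_p)$, $u=g_c(x_c,x_p)$ be a controller with state in $\mathbb R^{n_c}$ and output in $\mathbb R^{n_u}$. Write $x=(x_p,x_c)\in\mathbb R^n$, $e=(e_p,e_c)\in\mathbb R^n$, $$f(x,e)=\begin{pmatrix} f_p\big(x_p,\,g_c(x_c+e_c,\,x_p+e_p)\big)\\ f_c(x_c,\,x_p+e_p)\end{pmatrix},\qquad g=-f,$$ and assume that $f$ is continuous on $\mathbb R^n\times\mathbb R^n$. Let $m\ge 1$. For functions $S:\mathbb R^{m-1}\times\mathbb R^n\to\mathbb R^{m-1}$ and $\Gamma:\mathbb R^n\times\mathbb R^{m-1}\to\mathbb R$ consider the hybrid system with state $\xi=(x,e,\eta,\tau,s)\in\mathbb R^n\times\mathbb R^n\times\mathbb R^{m-1}\times\mathbb R\times\mathbb R$, $$\dot\xi=(f(x,e),\,g(x,e),\,0,\,1,\,0)\ \text{ if }\tau\le s,\qquad \xi^+=(x,\,0,\,S(\eta,x),\,0,\,\Gamma(x,\eta))\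 \text{ if }\tau=s .$$ Solutions are the usual hybrid arcs: defined on hybrid time domains in $\mathbb R_{\ge0}\times\mathbb N_0$, absolutely continuous in $t$ on compact intervals for each $j$, satisfying the flow condition for every $j$ and almost every $t$ and the jump condition at every jump. Only initial conditions with $\tau(0,0)\ge 0$ and $s(0,0)=\tau(0,0)$ are considered; $x(0,0),e(0,0)\in\mathbb R^n$ and $\eta(0,0)\in\mathbb R^{m-1}$ are arbitrary. The sampling instant $t_j$ is the time at which the solution jumps from $(t_j,j)$ to $(t_j,j+1)$. **Assumption.** There are a locally Lipschitz $V:\mathbb R^n\to\mathbb R_{\ge0}$ and finitely many triples $(\epsilon_i,\gamma_i,L_i)$, $i=1,\dots,n_{\mathrm{par}}$, $n_{\mathrm{par}}\ge 1$, with $\epsilon_i\in\mathbb R$, $\gamma_i,L_i>0$ and $\epsilon_1>0$, such that for each $i$ there exist a locally Lipschitz $W:\mathbb R^n\to\mathbb R_{\ge0}$, a continuous $H:\mathbb R^n\times\mathbb R^n\to\mathbb R_{\ge0}$ and $\underline\alpha_W,\overline\alpha_W,\underline\alpha_V,\overline\alpha_V\in\mathcal K_\infty$ (all of which may depend on $i$)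 with - $\underline\alpha_W(\|e\|)\le W(e)\le\overline\alpha_W(\|e\|)$ for all $e\in\mathbb R^n$ and $\underline\alpha_V(\|x\|)\le V(x)\le\overline\alpha_V(\|x\|)$ for all $x\in\mathbb R^n$; - for all $x\in\mathbb R^n$ and almost all $e\in\mathbb R^n$: $\langle\nabla W(e),g(x,e)\rangle\le L_iW(e)+H(x,e)$; - for all $e\in\mathbb R^n$ and almost all $x\in\mathbb R^n$: $\langle\nabla V(x),f(x,e)\rangle\le-\epsilon_iV(x)-H(x,e)^2+\gamma_i^2W(e)^2$. **Mechanism.** Let $\delta\in(0,1)$, $\epsilon_{\mathrm{ref}}>0$, and let $c\in(0,\infty]$ be such that $\mathcal R=\{x\mid V(x)\le c\}$ is all of $\mathbb R^n$ (for $n\ge1$ this means $c=\infty$). For $\gamma,\Lambda>0$ and $r=\sqrt{|(\gamma/\Lambda)^2-1|}$ put $$T_{\max}(\gamma,\Lambda)=\begin{cases}\frac1{\Lambda r}\arctan r&\gamma>\Lambda\\ \frac1\Lambda&\gamma=\Lambda\\ \frac1{\Lambda r}\operatorname{arctanh} r&\gamma<\Lambda.\end{cases}$$ Let $S(\eta,x)=(\eta_2,\dots,\eta_{m-1},V(x))$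 and $C(x,\eta)=\min\{c,\ \frac1m(V(x)+\sum_{k=1}^{m-1}\eta_k)\}$. Given $(x,\eta)$, write $V=V(x)$, $C=C(x,\eta)$, and for $i\ge2$ let $\Lambda_i=\max\{L_i+\frac{\epsilon_i}2,\,1-\delta\}$, $\theta_i=\delta T_{\max}(\gamma_i,\Lambda_i)$, and - if $C\ge V$: $\bar h_i=\min\{\theta_i,\ \frac{\log C-\log V}{\epsilon_{\mathrm{ref}}-\epsilon_i}\}$ when $\epsilon_{\mathrm{ref}}-\epsilon_i>0$, and $\bar h_i=\theta_i$ otherwise; - if $C<V$: $\bar h_i=\theta_i$ when $\epsilon_{\mathrm{ref}}-\epsilon_i<0$ and $\frac{\log C-\log V}{\epsilon_{\mathrm{ref}}-\epsilon_i}<\theta_i$, and $\bar h_i=0$ otherwise. In the degenerate cases the quotient is read as $+\infty$: so $\bar h_i=\theta_i$ if $V=0\le C$, and $\bar h_i=0$ if $C<V$ and $C\le0$. Finally, $\Gamma(x,\eta)$ is the maximum of $t_{\min}:=\delta T_{\max}(\gamma_1,L_1+\frac{\epsilon_1}2)$ and $\bar h_2,\dots,\bar h_{n_{\mathrm{par}}}$.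 **Corollary.** Consider the hybrid system with these $S$ and $\Gamma$. Then $t_{\min}>0$; for every solution and every $j\in\mathbb N_0$ for which the sampling instants $t_j,t_{j+1}$ occur, $t_{j+1}-t_j\ge t_{\min}$; and the set $\{(x,e,\eta,\tau,s): x=0,\ e=0,\ \eta=0\}$ is uniformly globally asymptotically stable, i.e. there is $\beta\in\mathcal{KLL}$ such that every solution with an initial condition as above satisfies $$\left\|\begin{pmatrix}x(t,j)\\e(t,j)\\\eta(t,j)\end{pmatrix}\right\|\le\beta\left(\left\|\begin{pmatrix}x(0,0)\\e(0,0)\\\eta(0,0)\end{pmatrix}\right\|,t,j\right)$$ for all $(t,j)$ in its domain. Here $\alpha:\mathbb R_{\ge0}\to\mathbb R_{\ge0}$ is of class $\mathcal K$ if it is continuous, strictly increasing and $\alpha(0)=0$, and of class $\mathcal K_\infty$ if it is moreover unbounded; $\beta(q,t)$ is of class $\mathcal{KL}$ if it is continuous, of class $\mathcal K$ in $q$, and nonincreasing with limit $0$ in $t$; $\beta(q,t,j)$ is of class $\mathcal{KLL}$ if $\beta(\cdot,r,\cdot)$ and $\beta(\cdot,\cdot,r)$ are of class $\mathcal{KL}$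 for every $r\ge0$. -/

import Mathlib

open Set Filter Topology MeasureTheory

namespace DynamicSTC

/-! ### Comparison functions -/

/-- Class `𝒦` functions on `[0, ∞)` (values of `α` at negative reals are irrelevant). -/
structure IsClassK (α : ℝ → ℝ) : Prop where
  continuousOn : ContinuousOn α (Ici 0)
  strictMonoOn : StrictMonoOn α (Ici 0)
  map_zero : α 0 = 0

/-- Class `𝒦_∞` functions: class `𝒦` and unbounded. -/
structure IsClassKInf (α : ℝ → ℝ) : Prop extends IsClassK α where
  unbounded : ∀ M : ℝ, ∃ q : ℝ, 0 ≤ q ∧ M < α q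

/-- Class `𝒦ℒ` functions on `[0, ∞) × [0, ∞)`. -/
structure IsClassKL (β : ℝ → ℝ → ℝ) : Prop where
  continuousOn : ContinuousOn (fun p : ℝ × ℝ => β p.1 p.2) (Ici 0 ×ˢ Ici 0)
  classK : ∀ t : ℝ, 0 ≤ t → IsClassK (fun q => β q t)
  antitoneOn : ∀ q : ℝ, 0 ≤ q → AntitoneOn (β q) (Ici 0)
  tendsto_zero : ∀ q : ℝ, 0 ≤ q → Tendsto (β q) atTop (𝓝 0)

/-- Class `𝒦ℒℒ` functions on `[0, ∞) × [0, ∞) × [0, ∞)`. -/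
structure IsClassKLL (β : ℝ → ℝ → ℝ → ℝ) : Prop where
  left : ∀ r : ℝ, 0 ≤ r → IsClassKL (fun q s => β q r s)
  right : ∀ r : ℝ, 0 ≤ r → IsClassKL (fun q s => β q s r)

/-! ### Hybrid systems and their solutions -/

/-- The data of a hybrid system `ξ' = F(ξ)` for `ξ ∈ C`, `ξ⁺ = G(ξ)` for `ξ ∈ D`. -/
structure HybridSystem (E : Type*) where
  flowSet : Set E
  flowMap : E → E
  jumpSet : Set E
  jumpMap : E → E

/-- Compact hybrid time domains: `⋃_{j < J} [t_j, t_{j+1}] × {j}` with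
`0 = t_0 ≤ t_1 ≤ ⋯ ≤ t_J`. -/
def IsCompactHybridTimeDomain (T : Set (ℝ × ℕ)) : Prop :=
  ∃ (J : ℕ) (t : ℕ → ℝ), t 0 = 0 ∧ (∀ j < J, t j ≤ t (j + 1)) ∧
    T = {p : ℝ × ℕ | p.2 < J ∧ t p.2 ≤ p.1 ∧ p.1 ≤ t (p.2 + 1)}

/-- Hybrid time domains: all truncations `T ∩ ([0, t] × {0, …, j})` with `(t, j) ∈ T` are compact
hybrid time domains. -/
structure IsHybridTimeDomain (T : Set (ℝ × ℕ)) : Prop where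
  nonempty : T.Nonempty
  nonneg : ∀ p ∈ T, 0 ≤ p.1
  truncation : ∀ p ∈ T, IsCompactHybridTimeDomain (T ∩ (Icc 0 p.1 ×ˢ Iic p.2))

/-- `ξ : (t, j) ↦ ξ t j`, with domain `T`, is a solution of the hybrid system `H`. Values of `ξ`
outside of `T` are irrelevant. -/
structure IsSolution {E : Type*} [NormedAddCommGroup E] [NormedSpace ℝ E]
    (H : HybridSystem E) (T : Set (ℝ × ℕ)) (ξ : ℝ → ℕ → E) : Prop where
  timeDomain : IsHybridTimeDomain T
  absolutelyContinuous : ∀ (j : ℕ) (a b : ℝ), (a, j) ∈ T → (b, j) ∈ T →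
    AbsolutelyContinuousOnInterval (fun t => ξ t j) a b
  flow : ∀ j : ℕ, ∀ᵐ t : ℝ, (t, j) ∈ T → ξ t j ∈ H.flowSet ∧
    HasDerivWithinAt (fun s => ξ s j) (H.flowMap (ξ t j)) {s : ℝ | (s, j) ∈ T} t
  jump : ∀ (t : ℝ) (j : ℕ), (t, j) ∈ T → (t, j + 1) ∈ T →
    ξ t j ∈ H.jumpSet ∧ ξ t (j + 1) = H.jumpMap (ξ t j)

/-! ### Plant, controller and the networked control system -/

/-- Combined plant and controller vectors `[x_p; x_c] ∈ ℝ^{n_p + n_c}`, with Euclidean norm. -/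
abbrev Vec (np nc : ℕ) : Type := EuclideanSpace ℝ (Fin np ⊕ Fin nc)

/-- The plant component `x_p` of `x = [x_p; x_c]`. -/
def plantPart {np nc : ℕ} (x : Vec np nc) : EuclideanSpace ℝ (Fin np) :=
  WithLp.toLp 2 fun i => x (Sum.inl i)

/-- The controller component `x_c` of `x = [x_p; x_c]`. -/
def ctrlPart {np nc : ℕ} (x : Vec np nc) : EuclideanSpace ℝ (Fin nc) :=
  WithLp.toLp 2 fun i => x (Sum.inr i)

/-- The closed-loop vector field
`f(x, e) = [f_p(x_p, g_c(x_c + e_c, x_p + e_p)); f_c(x_c, x_p + e_p)]`. -/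
def closedLoop {np nc nu : ℕ}
    (fp : EuclideanSpace ℝ (Fin np) → EuclideanSpace ℝ (Fin nu) → EuclideanSpace ℝ (Fin np))
    (fc : EuclideanSpace ℝ (Fin nc) → EuclideanSpace ℝ (Fin np) → EuclideanSpace ℝ (Fin nc))
    (gc : EuclideanSpace ℝ (Fin nc) → EuclideanSpace ℝ (Fin np) → EuclideanSpace ℝ (Fin nu))
    (x e : Vec np nc) : Vec np nc :=
  WithLp.toLp 2 (Sum.elim
    (fun i => fp (plantPart x)
      (gc (ctrlPart x + ctrlPart e) (plantPart x + plantPart e)) i)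
    (fun i => fc (ctrlPart x) (plantPart x + plantPart e) i))

/-- Hybrid states `ξ = (x, e, η, τ, s)`: state, sampling-induced error, dynamic variable, timer,
current sampling interval. -/
abbrev State (np nc nη : ℕ) : Type :=
  Vec np nc × Vec np nc × EuclideanSpace ℝ (Fin nη) × ℝ × ℝ

namespace State

variable {np nc nη : ℕ}

/-- The component `x`. -/
def x (ξ : State np nc nη) : Vec np nc := ξ.1

/-- The component `e`. -/
def e (ξ : State np nc nη) : Vec np nc := ξ.2.1

/-- The component `η`. -/
def eta (ξ : State np nc nη) : EuclideanSpace ℝ (Fin nη) := ξ.2.2.1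

/-- The timer `τ`. -/
def timer (ξ : State np nc nη) : ℝ := ξ.2.2.2.1

/-- The sampling interval `s`. -/
def interval (ξ : State np nc nη) : ℝ := ξ.2.2.2.2

/-- The Euclidean norm of the stacked vector `[x; e; η]`. -/
noncomputable def stackedNorm (ξ : State np nc nη) : ℝ :=
  Real.sqrt (‖ξ.x‖ ^ 2 + ‖ξ.e‖ ^ 2 + ‖ξ.eta‖ ^ 2)

end State

/-- The hybrid system of the self-triggered loop with vector field `f`, trigger rule `Γ` and update
rule `S` of the dynamic variable. -/
def stcSystem {np nc nη : ℕ} (f : Vec np nc → Vec np nc → Vec np nc)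
    (S : EuclideanSpace ℝ (Fin nη) → Vec np nc → EuclideanSpace ℝ (Fin nη))
    (Γ : Vec np nc → EuclideanSpace ℝ (Fin nη) → ℝ) : HybridSystem (State np nc nη) where
  flowSet := {ξ | ξ.timer ≤ ξ.interval}
  flowMap ξ := (f ξ.x ξ.e, -f ξ.x ξ.e, 0, 1, 0)
  jumpSet := {ξ | ξ.timer = ξ.interval}
  jumpMap ξ := (ξ.x, 0, S ξ.eta ξ.x, 0, Γ ξ.x ξ.eta)

/-- Initial conditions with `x(0,0) ∈ R`, `τ(0,0) ≥ 0`, `s(0,0) = τ(0,0)` and arbitrary `e(0,0)`,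
`η(0,0)`. -/
def IsInitial {np nc nη : ℕ} (R : Set (Vec np nc)) (ξ₀ : State np nc nη) : Prop :=
  ξ₀.x ∈ R ∧ 0 ≤ ξ₀.timer ∧ ξ₀.interval = ξ₀.timer

/-- Asymptotic stability of `{x = 0, e = 0, η = 0}` with region of attraction `R`. -/
def IsAsymptoticallyStable {np nc nη : ℕ} (H : HybridSystem (State np nc nη))
    (R : Set (Vec np nc)) : Prop :=
  ∃ β : ℝ → ℝ → ℝ → ℝ, IsClassKLL β ∧
    ∀ (T : Set (ℝ × ℕ)) (ξ : ℝ → ℕ → State np nc nη), IsSolution H T ξ → IsInitial R (ξ 0 0) →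
      ∀ (t : ℝ) (j : ℕ), (t, j) ∈ T →
        (ξ t j).stackedNorm ≤ β (ξ 0 0).stackedNorm t j

/-- Uniform global asymptotic stability of `{x = 0, e = 0, η = 0}`. -/
def IsUGAS {np nc nη : ℕ} (H : HybridSystem (State np nc nη)) : Prop :=
  IsAsymptoticallyStable H univ

/-- `t` is the sampling instant `t_j`, i.e. the solution with domain `T` jumps from `(t, j)` to
`(t, j + 1)`. -/
def IsSamplingInstant (T : Set (ℝ × ℕ)) (j : ℕ) (t : ℝ) : Prop :=
  (t, j) ∈ T ∧ (t, j + 1) ∈ T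

/-! ### The hybrid Lyapunov assumption, in its global form -/

/-- The global Lyapunov assumption on `f` and `g = -f` for the function `V` and the parameters
`ε`, `γ`, `L`. -/
def LyapunovAssumption {np nc : ℕ} (f : Vec np nc → Vec np nc → Vec np nc)
    (V : Vec np nc → ℝ) (ε γ L : ℝ) : Prop :=
  0 < L ∧ 0 < γ ∧ LocallyLipschitz V ∧ (∀ x, 0 ≤ V x) ∧
  ∃ (W : Vec np nc → ℝ) (H : Vec np nc → Vec np nc → ℝ) (αW₁ αW₂ αV₁ αV₂ : ℝ → ℝ),
    LocallyLipschitz W ∧ (∀ e, 0 ≤ W e) ∧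
    Continuous (fun p : Vec np nc × Vec np nc => H p.1 p.2) ∧ (∀ x e, 0 ≤ H x e) ∧
    IsClassKInf αW₁ ∧ IsClassKInf αW₂ ∧ IsClassKInf αV₁ ∧ IsClassKInf αV₂ ∧
    (∀ e, αW₁ ‖e‖ ≤ W e ∧ W e ≤ αW₂ ‖e‖) ∧
    (∀ x, αV₁ ‖x‖ ≤ V x ∧ V x ≤ αV₂ ‖x‖) ∧
    (∀ x, ∀ᵐ e : Vec np nc, inner ℝ (gradient W e) (-f x e) ≤ L * W e + H x e) ∧
    (∀ e, ∀ᵐ x : Vec np nc,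
      inner ℝ (gradient V x) (f x e) ≤ -ε * V x - H x e ^ 2 + γ ^ 2 * W e ^ 2)

/-! ### The dynamic self-triggered sampling mechanism -/

/-- The function `T_max(γ, Λ)`. -/
noncomputable def Tmax (γ Λ : ℝ) : ℝ :=
  let r := Real.sqrt |(γ / Λ) ^ 2 - 1|
  if Λ < γ then 1 / (Λ * r) * Real.arctan r
  else if γ = Λ then 1 / Λ
  else 1 / (Λ * r) * Real.artanh r

/-- The update `S(η, x) = (η_2, …, η_{m-1}, V(x))` of the dynamic variable. -/
noncomputable def etaUpdate {np nc : ℕ} (m : ℕ) (V : Vec np nc → ℝ)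
    (η : EuclideanSpace ℝ (Fin (m - 1))) (x : Vec np nc) : EuclideanSpace ℝ (Fin (m - 1)) :=
  WithLp.toLp 2 fun k => if h : k.val + 1 < m - 1 then η ⟨k.val + 1, h⟩ else V x

/-- The reference value `C(x, η, c) = min {c, (V(x) + η_1 + ⋯ + η_{m-1}) / m}`, where
`c ∈ (0, ∞]`. -/
noncomputable def refValue {np nc : ℕ} (m : ℕ) (V : Vec np nc → ℝ) (c : EReal)
    (x : Vec np nc) (η : EuclideanSpace ℝ (Fin (m - 1))) : ℝ :=
  (min c (((1 / m : ℝ) * (V x + ∑ k, η k) : ℝ) : EReal)).toReal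

/-- The candidate interval `h_i` that the algorithm computes for one parameter set `ε`, `γ`, `L`
from the current values `v` of `V(x)` and `C` of the reference value. The two degenerate logarithms
follow the convention `log 0 = -∞` for the inequality
`e^{-ε h} v ≤ e^{-εref h} C` that the algorithm solves for `h`: if `v = 0 ≤ C`, every `h` solves it;
if `C < v` and `C ≤ 0`, no `h` does. -/
noncomputable def candidate (δ εref v C ε γ L : ℝ) : ℝ :=
  let Λ := max (L + ε / 2) (1 - δ)
  if v ≤ C then
    if 0 < -ε + εref then
      if v = 0 then δ * Tmax γ Λ
      else min (δ * Tmax γ Λ) ((Real.log C - Real.log v) / (-ε + εref))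
    else δ * Tmax γ Λ
  else
    if 0 ≤ -ε + εref then 0
    else if C ≤ 0 then 0
    else if (Real.log C - Real.log v) / (-ε + εref) < δ * Tmax γ Λ then δ * Tmax γ Λ
    else 0

/-- The trigger rule `Γ(x, η)`. The parameter set with index `0` is the one used for the fall-back
interval; the loop runs over the other `N` parameter sets. -/
noncomputable def trigger {np nc : ℕ} (m : ℕ) (V : Vec np nc → ℝ) (c : EReal) (δ εref : ℝ)
    {N : ℕ} (ε γ L : Fin (N + 1) → ℝ)
    (x : Vec np nc) (η : EuclideanSpace ℝ (Fin (m - 1))) : ℝ :=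
  let h : Fin N → ℝ := fun i =>
    candidate δ εref (V x) (refValue m V c x η) (ε i.succ) (γ i.succ) (L i.succ)
  (List.finRange N).foldl (fun hbar i => if hbar < h i then h i else hbar)
    (δ * Tmax (γ 0) (L 0 + ε 0 / 2))

end DynamicSTC

/-!
Between two samples the closed loop is certified by the function
`U = V x + γ * φ (τ) * W e ^ 2`, where `φ` solves the Riccati equation
`φ' = -2 Λ φ - γ (φ ^ 2 + 1)` with `Λ ≥ L + ε / 2`. Completing the square in the two gradient
inequalities gives `U' ≤ -ε U`. The time in which a solution of the Riccati equation falls from `+∞`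
to `0` is `Tmax γ Λ`, so for every horizon below it there is a finite and positive `φ`
(`exists_riccati_solution`). As `e` is reset to `0` at each sample, `V` at the next sample is at
most `exp (-ε h)` times its present value, and between the samples `x` and `e` are bounded by a
class `𝒦` function of that value (`LyapunovAssumption.exists_flow_bound`).

The gradient inequalities hold only almost everywhere, and a trajectory may stay in the exceptional
null set. Fubini's theorem turns them into bounds on the increments of `V` and `W` along all short
segments (`LipschitzOnWith.le_add_mul_of_ae_fderiv_le`), hence into bounds on the Dini derivatives
along trajectories (`eventually_le_of_ae_inner_gradient_le`), which is all Grönwall's inequality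
needs. Trajectories have one-sided derivatives everywhere because an absolutely continuous curve
whose derivative is almost everywhere equal to a continuous function is differentiable
(`AbsolutelyContinuousOnInterval.hasDerivWithinAt_of_ae`).

The trigger rule picks an interval `h ≥ tmin` and a parameter set `i` for which `exp (-ε i * h) * V`
is at most `exp (-min (ε 0) εref * tmin)` times the maximum of the last `m` values of `V`
(`trigger_spec`). A window of `m` values under such a recursion decays exponentially, which one sees
in one step with weights that grow with the age of the value (`WindowBound.step`). The intervals are
bounded above too, so decay in the number of samples is decay in `t + j`, and the bound is a class
`𝒦` function of `exp (-κ (t + j))` times a class `𝒦` function of the initial state.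
-/

namespace DynamicSTC

/-! ### Nonsmooth calculus along trajectories -/

lemma le_add_mul_of_ae_deriv_le {g : ℝ → ℝ} {K : NNReal} {s r : ℝ} (hs : 0 ≤ s)
    (hg : LipschitzOnWith K g (Icc 0 s)) (h : ∀ᵐ t : ℝ, t ∈ Ioo 0 s → deriv g t ≤ r) :
    g s ≤ g 0 + r * s := by
  have hac : AbsolutelyContinuousOnInterval g 0 s :=
    LipschitzOnWith.absolutelyContinuousOnInterval (by rwa [uIcc_of_le hs])
  have h1 := hac.integral_deriv_eq_sub
  have h2 : ∫ t in (0 : ℝ)..s, deriv g t ≤ ∫ _t in (0 : ℝ)..s, r := by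
    simp only [intervalIntegral.integral_of_le hs, integral_Ioc_eq_integral_Ioo]
    apply setIntegral_mono_ae_restrict
    · exact (hac.intervalIntegrable_deriv.1).mono Ioo_subset_Ioc_self le_rfl
    · exact integrableOn_const (by simp)
    · exact (ae_restrict_iff' measurableSet_Ioo).2 h
  rw [h1] at h2
  simp only [intervalIntegral.integral_const, sub_zero, smul_eq_mul] at h2
  linarith

/-- An almost-everywhere bound on a directional derivative of a Lipschitz function bounds every
increment in that direction, even along segments inside the exceptional null set: by Fubini the
bound holds on almost every parallel segment, and these are dense. -/
lemma _root_.LipschitzOnWith.le_add_mul_of_ae_fderiv_le {E : Type*} [NormedAddCommGroup E]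
    [NormedSpace ℝ E] [FiniteDimensional ℝ E] [MeasurableSpace E] [BorelSpace E]
    (μ : Measure E) [μ.IsAddHaarMeasure] {V : E → ℝ} {K : NNReal} {U : Set E}
    (hU : IsOpen U) (hconv : Convex ℝ U) (hV : LipschitzOnWith K V U) {v : E} {r : ℝ}
    (h : ∀ᵐ y ∂μ, y ∈ U → fderiv ℝ V y v ≤ r) {x : E} {s : ℝ} (hs : 0 ≤ s) (hx : x ∈ U)
    (hxs : x + s • v ∈ U) : V (x + s • v) ≤ V x + r * s := by
  have hgood : ∀ᵐ y ∂μ, y ∈ U → DifferentiableAt ℝ V y ∧ fderiv ℝ V y v ≤ r := by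
    filter_upwards [h, hV.ae_differentiableWithinAt_of_mem (μ := μ)] with y h1 h2 hy
    exact ⟨(h2 hy).differentiableAt (hU.mem_nhds hy), h1 hy⟩
  obtain ⟨G, hG, hGm, hGs⟩ := hgood.exists_measurable_mem
  let ℓ : ℝ →L[ℝ] E := ContinuousLinearMap.toSpanSingleton ℝ v
  have hfub : ∀ᵐ y ∂μ, ∀ᵐ t : ℝ, y + ℓ.toLinearMap t ∈ G :=
    (ae_ae_add_linearMap_mem_iff ℓ.toLinearMap volume μ hGm).2 hG
  have hdense : Dense {y | ∀ᵐ t : ℝ, y + ℓ.toLinearMap t ∈ G} :=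
    Measure.dense_of_ae hfub
  have key : ∀ y, (∀ᵐ t : ℝ, y + ℓ.toLinearMap t ∈ G) → y ∈ U → y + s • v ∈ U →
      V (y + s • v) ≤ V y + r * s := by
    intro y hy hyU hysU
    have hseg : ∀ t ∈ Icc 0 s, y + t • v ∈ U := by
      intro t ht
      rcases hs.eq_or_lt with rfl | hs0
      · have : t = 0 := le_antisymm ht.2 ht.1
        simpa [this] using hyU
      · have := hconv.add_smul_mem hyU hysU (t := t / s)
          ⟨div_nonneg ht.1 hs, (div_le_one hs0).2 ht.2⟩
        rwa [smul_smul, div_mul_cancel₀ _ hs0.ne'] at this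
    have hlip : LipschitzOnWith (K * ‖v‖₊) (fun t : ℝ => V (y + t • v)) (Icc 0 s) := by
      have h2 : LipschitzOnWith ‖v‖₊ (fun t : ℝ => y + t • v) (Icc 0 s) := by
        refine LipschitzWith.lipschitzOnWith (LipschitzWith.of_dist_le_mul fun a b => ?_)
        rw [dist_add_left, dist_eq_norm, ← sub_smul, norm_smul, coe_nnnorm, mul_comm,
          Real.dist_eq, Real.norm_eq_abs]
      exact hV.comp h2 hseg
    have := le_add_mul_of_ae_deriv_le (r := r) hs hlip (by
      filter_upwards [hy] with t ht hts
      have h3 := hGs _ ht (by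
        have := hseg t (Ioo_subset_Icc_self hts)
        simpa [ℓ] using this)
      have h4 : HasDerivAt (fun t : ℝ => y + t • v) v t := by
        simpa using ((hasDerivAt_id t).smul_const v).const_add y
      have h5 : DifferentiableAt ℝ V (y + t • v) := by simpa [ℓ] using h3.1
      have h6 := h5.hasFDerivAt.comp_hasDerivAt t h4
      have h7 : deriv (fun t : ℝ => V (y + t • v)) t = fderiv ℝ V (y + t • v) v := h6.deriv
      rw [h7]
      simpa [ℓ] using h3.2)
    simpa using this
  by_contra hcon
  push Not at hcon
  have hc1 : ContinuousAt V x := hV.continuousOn.continuousAt (hU.mem_nhds hx)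
  have hadd : ContinuousAt (fun y : E => y + s • v) x := by fun_prop
  have hc2 : ContinuousAt (fun y => V (y + s • v)) x :=
    ContinuousAt.comp (f := fun y => y + s • v)
      (hV.continuousOn.continuousAt (hU.mem_nhds hxs)) hadd
  have hev : ∀ᶠ y in 𝓝 x, (V y + r * s < V (y + s • v) ∧ y ∈ U) ∧ y + s • v ∈ U :=
    (((hc1.add continuousAt_const).eventually_lt hc2 hcon).and (hU.mem_nhds hx)).and
      (hadd.eventually (hU.mem_nhds hxs))
  obtain ⟨y, hy, hyG⟩ := (mem_closure_iff_nhds.1 (hdense x) _ hev)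
  exact absurd (key y hyG hy.1.2 hy.2) (not_le.2 hy.1.1)

/-- A Dini-derivative bound: the gradient inequality is required only almost everywhere, and yet it
bounds the right difference quotients of `V` along every curve whose right derivative is `F x₀`. -/
lemma eventually_le_of_ae_inner_gradient_le {E : Type*} [NormedAddCommGroup E]
    [InnerProductSpace ℝ E] [FiniteDimensional ℝ E] [MeasurableSpace E] [BorelSpace E]
    (μ : Measure E) [μ.IsAddHaarMeasure] {V : E → ℝ} (hV : LocallyLipschitz V)
    {F : E → E} {R : E → ℝ} (hF : Continuous F) (hR : Continuous R)
    (h : ∀ᵐ y ∂μ, inner ℝ (gradient V y) (F y) ≤ R y) {c : ℝ → E} {t : ℝ}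
    (hc : HasDerivWithinAt c (F (c t)) (Ici t) t) {r : ℝ} (hr : R (c t) < r) :
    ∀ᶠ z in 𝓝[>] t, V (c z) ≤ V (c t) + r * (z - t) := by
  set x₀ := c t with hx₀
  set v := F x₀ with hv
  obtain ⟨K, U, hU, hK⟩ := hV x₀
  obtain ⟨r', hr1, hr2⟩ := exists_between hr
  -- near `x₀` the frozen direction `F x₀` costs at most `K * ‖F y - F x₀‖`
  have hev : ∀ᶠ y in 𝓝 x₀, R y + K * ‖v - F y‖ < r' := by
    have : ContinuousAt (fun y => R y + K * ‖v - F y‖) x₀ := by fun_prop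
    exact this.eventually_lt continuousAt_const (by simpa [hv] using hr1)
  obtain ⟨ρ, hρ, hball⟩ := Metric.mem_nhds_iff.1 (inter_mem hU hev)
  have hKb : LipschitzOnWith K V (Metric.ball x₀ ρ) := hK.mono fun y hy => (hball hy).1
  have hae : ∀ᵐ y ∂μ, y ∈ Metric.ball x₀ ρ → fderiv ℝ V y v ≤ r' := by
    filter_upwards [h] with y hy hyb
    have h1 : fderiv ℝ V y (F y) ≤ R y := by
      have : inner ℝ (gradient V y) (F y) = fderiv ℝ V y (F y) := by
        simp [gradient]
      rwa [this] at hy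
    have h2 : fderiv ℝ V y (v - F y) ≤ K * ‖v - F y‖ :=
      (le_abs_self _).trans (((fderiv ℝ V y).le_opNorm _).trans
        (mul_le_mul_of_nonneg_right
          (norm_fderiv_le_of_lipschitzOn ℝ (Metric.isOpen_ball.mem_nhds hyb) hKb)
          (norm_nonneg _)))
    have h3 : fderiv ℝ V y v = fderiv ℝ V y (F y) + fderiv ℝ V y (v - F y) := by
      rw [← map_add]; congr 1; abel
    have h4 : R y + K * ‖v - F y‖ < r' := (hball hyb).2
    linarith
  have hstep : ∀ᶠ z in 𝓝[>] t, x₀ + (z - t) • v ∈ Metric.ball x₀ ρ := by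
    have : ContinuousAt (fun z : ℝ => x₀ + (z - t) • v) t := by fun_prop
    refine (this.eventually_mem ?_).filter_mono nhdsWithin_le_nhds
    rw [sub_self, zero_smul, add_zero]
    exact Metric.isOpen_ball.mem_nhds (Metric.mem_ball_self hρ)
  have hcin : ∀ᶠ z in 𝓝[>] t, c z ∈ Metric.ball x₀ ρ :=
    ((hc.continuousWithinAt).mono Ioi_subset_Ici_self).eventually
      (Metric.isOpen_ball.mem_nhds (Metric.mem_ball_self hρ))
  have hlit : ∀ᶠ z in 𝓝[>] t, ‖c z - x₀ - (z - t) • v‖ ≤ ((r - r') / (K + 1)) * ‖z - t‖ := by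
    have := (hasDerivWithinAt_iff_isLittleO.1 (hc.mono Ioi_subset_Ici_self)).def
      (show 0 < (r - r') / (K + 1) from div_pos (by linarith) (by positivity))
    exact this
  filter_upwards [hstep, hcin, hlit, self_mem_nhdsWithin] with z h1 h2 h3 h4
  have hz : 0 < z - t := sub_pos.2 h4
  have h5 := hKb.le_add_mul_of_ae_fderiv_le μ Metric.isOpen_ball (convex_ball _ _) hae hz.le
    (Metric.mem_ball_self hρ) h1
  have h6 : V (c z) - V (x₀ + (z - t) • v) ≤ K * ‖c z - (x₀ + (z - t) • v)‖ :=
    (le_abs_self _).trans (hKb.norm_sub_le h2 h1)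
  have h7 : K * ‖c z - (x₀ + (z - t) • v)‖ ≤ (r - r') * (z - t) := by
    rw [← sub_sub]
    rw [Real.norm_of_nonneg hz.le] at h3
    calc K * ‖c z - x₀ - (z - t) • v‖ ≤ (K + 1) * ((r - r') / (K + 1) * (z - t)) := by
          gcongr
          linarith
      _ = (r - r') * (z - t) := by field_simp
  linarith

/-- An absolutely continuous curve whose derivative agrees almost everywhere with a continuous
function has that derivative everywhere. -/
lemma _root_.AbsolutelyContinuousOnInterval.hasDerivWithinAt_of_ae {E : Type*}
    [NormedAddCommGroup E] [NormedSpace ℝ E] [CompleteSpace E] {f F : ℝ → E} {a b : ℝ}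
    (hab : a ≤ b) (hf : AbsolutelyContinuousOnInterval f a b) (hF : ContinuousOn F (Icc a b))
    (h : ∀ᵐ t : ℝ, t ∈ Icc a b → HasDerivWithinAt f (F t) (Icc a b) t) :
    ∀ t ∈ Icc a b, HasDerivWithinAt f (F t) (Icc a b) t := by
  let F' : ℝ → E := IccExtend hab ((Icc a b).domRestrict F)
  have hF' : Continuous F' := hF.domRestrict.Icc_extend'
  have hFF' : ∀ t ∈ Icc a b, F' t = F t := fun t ht =>
    IccExtend_of_mem hab _ ht
  let I : ℝ → E := fun t => ∫ s in a..t, F' s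
  have hI : ∀ t, HasDerivAt I (F' t) t := fun t => hF'.integral_hasStrictDerivAt a t |>.hasDerivAt
  have hIac : AbsolutelyContinuousOnInterval I a b := by
    apply ContDiffOn.absolutelyContinuousOnInterval
    have : ContDiff ℝ 1 I := by
      rw [contDiff_one_iff_deriv]
      refine ⟨fun t => (hI t).differentiableAt, ?_⟩
      rwa [show deriv I = F' from funext fun t => (hI t).deriv]
    exact this.contDiffOn
  obtain ⟨C, hC⟩ := (hf.sub hIac).const_of_ae_hasDerivAt_zero (by
    have hae : ∀ᵐ t : ℝ, t ≠ a ∧ t ≠ b := by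
      have h1 : ∀ᵐ t : ℝ, t ≠ a := by simp [ae_iff]
      have h2 : ∀ᵐ t : ℝ, t ≠ b := by simp [ae_iff]
      exact h1.and h2
    filter_upwards [h, hae] with t ht hne hmem
    rw [uIcc_of_le hab] at hmem
    have h1 : HasDerivAt f (F t) t := (ht hmem).hasDerivAt
      (Icc_mem_nhds (lt_of_le_of_ne hmem.1 hne.1.symm) (lt_of_le_of_ne hmem.2 hne.2))
    have h2 := h1.sub (hI t)
    rwa [hFF' t hmem, sub_self] at h2)
  rw [uIcc_of_le hab] at hC
  intro t ht
  rw [← hFF' t ht]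
  refine (((hI t).const_add C).hasDerivWithinAt).congr (fun s hs => ?_) ?_
  · rw [← hC s hs]; simp
  · rw [← hC t ht]; simp

/-! ### The Riccati equation behind `Tmax` -/

/-- `Tmax γ Λ` is the first zero of `c - Λ * s`, where `s` and `c` are the generalized sine and
cosine with `s'' = (Λ² - γ²) s`. -/
lemma exists_generalized_sin_cos {γ Λ : ℝ} (hγ : 0 < γ) (hΛ : 0 < Λ) :
    0 < Tmax γ Λ ∧ ∃ s c : ℝ → ℝ, (∀ t, HasDerivAt s (c t) t) ∧
      (∀ t, HasDerivAt c ((Λ ^ 2 - γ ^ 2) * s t) t) ∧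
      (∀ t ∈ Ioo 0 (Tmax γ Λ), 0 < s t) ∧ (∀ t ∈ Ioo 0 (Tmax γ Λ), 0 < c t - Λ * s t) := by
  rcases lt_trichotomy Λ γ with hlt | heq | hgt
  · -- trigonometric case
    set r := Real.sqrt |(γ / Λ) ^ 2 - 1| with hr
    have h1 : 1 < γ / Λ := (one_lt_div hΛ).2 hlt
    have h2 : 0 < (γ / Λ) ^ 2 - 1 := by nlinarith
    have hr0 : 0 < r := Real.sqrt_pos.2 (abs_pos.2 h2.ne')
    have hr2 : r ^ 2 = (γ / Λ) ^ 2 - 1 := by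
      rw [hr, Real.sq_sqrt (abs_nonneg _), abs_of_pos h2]
    set ω := Λ * r with hω
    have hω0 : 0 < ω := mul_pos hΛ hr0
    have hω2 : ω ^ 2 = γ ^ 2 - Λ ^ 2 := by
      rw [hω, mul_pow, hr2]; field_simp
    have hT : Tmax γ Λ = 1 / ω * Real.arctan r := by simp [Tmax, hlt, ← hr, hω]
    have hat : 0 < Real.arctan r := Real.arctan_pos.2 hr0
    have hpi := Real.arctan_lt_pi_div_two r
    have hang : ∀ t ∈ Ioo 0 (Tmax γ Λ), 0 < ω * t ∧ ω * t < Real.arctan r := by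
      intro t ht
      refine ⟨mul_pos hω0 ht.1, ?_⟩
      have := mul_lt_mul_of_pos_left ht.2 hω0
      rwa [hT, ← mul_assoc, mul_one_div_cancel hω0.ne', one_mul] at this
    refine ⟨by rw [hT]; positivity, fun t => Real.sin (ω * t) / ω, fun t => Real.cos (ω * t),
      ?_, ?_, ?_, ?_⟩
    · intro t
      exact ((hasDerivAt_const_mul ω (x := t)).sin.div_const ω).congr_deriv (by field_simp)
    · intro t
      refine (hasDerivAt_const_mul ω (x := t)).cos.congr_deriv ?_
      rw [show Λ ^ 2 - γ ^ 2 = -ω ^ 2 by rw [hω2]; ring]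
      field_simp
    · intro t ht
      obtain ⟨h3, h4⟩ := hang t ht
      exact div_pos (Real.sin_pos_of_pos_of_lt_pi h3 (by linarith [Real.pi_pos])) hω0
    · intro t ht
      obtain ⟨h3, h4⟩ := hang t ht
      have hcos : 0 < Real.cos (ω * t) :=
        Real.cos_pos_of_mem_Ioo ⟨by linarith [Real.pi_pos], by linarith⟩
      have htan : Real.tan (ω * t) < r := by
        have := Real.tan_lt_tan_of_lt_of_lt_pi_div_two (by linarith [Real.pi_pos]) hpi h4
        rwa [Real.tan_arctan] at this
      rw [Real.tan_eq_sin_div_cos, div_lt_iff₀ hcos] at htan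
      have : Λ * (Real.sin (ω * t) / ω) = Real.sin (ω * t) / r := by
        rw [hω]; field_simp
      rw [this, sub_pos, div_lt_iff₀ hr0]
      linarith
  · -- affine case
    subst heq
    have hT : Tmax Λ Λ = 1 / Λ := by simp [Tmax]
    refine ⟨by rw [hT]; positivity, fun t => t, fun _ => 1, fun t => hasDerivAt_id t, ?_, ?_, ?_⟩
    · intro t; simpa using hasDerivAt_const t (1 : ℝ)
    · exact fun t ht => ht.1
    · intro t ht
      have := ht.2
      rw [hT, lt_div_iff₀ hΛ] at this
      dsimp only
      linarith
  · -- hyperbolic case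
    set r := Real.sqrt |(γ / Λ) ^ 2 - 1| with hr
    have h0 : 0 < γ / Λ := div_pos hγ hΛ
    have h1 : γ / Λ < 1 := (div_lt_one hΛ).2 hgt
    have h2 : (γ / Λ) ^ 2 - 1 < 0 := by nlinarith
    have hr0 : 0 < r := Real.sqrt_pos.2 (abs_pos.2 h2.ne)
    have hr2 : r ^ 2 = 1 - (γ / Λ) ^ 2 := by
      rw [hr, Real.sq_sqrt (abs_nonneg _), abs_of_neg h2]; ring
    have hr1 : r < 1 := by nlinarith [sq_nonneg (γ / Λ), pow_pos h0 2]
    have hrm : r ∈ Ioo (-1 : ℝ) 1 := ⟨by linarith, hr1⟩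
    set ω := Λ * r with hω
    have hω0 : 0 < ω := mul_pos hΛ hr0
    have hω2 : ω ^ 2 = Λ ^ 2 - γ ^ 2 := by
      rw [hω, mul_pow, hr2]; field_simp
    have hT : Tmax γ Λ = 1 / ω * Real.artanh r := by
      simp [Tmax, hgt.not_gt, hgt.ne, ← hr, hω]
    have hat : 0 < Real.artanh r := Real.artanh_pos ⟨hr0, hr1⟩
    refine ⟨by rw [hT]; positivity, fun t => Real.sinh (ω * t) / ω, fun t => Real.cosh (ω * t),
      ?_, ?_, ?_, ?_⟩
    · intro t
      exact ((hasDerivAt_const_mul ω (x := t)).sinh.div_const ω).congr_deriv (by field_simp)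
    · intro t
      refine (hasDerivAt_const_mul ω (x := t)).cosh.congr_deriv ?_
      rw [← hω2]
      field_simp
    · intro t ht
      exact div_pos (Real.sinh_pos_iff.2 (mul_pos hω0 ht.1)) hω0
    · intro t ht
      have h3 : ω * t < Real.artanh r := by
        have := mul_lt_mul_of_pos_left ht.2 hω0
        rwa [hT, ← mul_assoc, mul_one_div_cancel hω0.ne', one_mul] at this
      have htanh : Real.tanh (ω * t) < r := by
        have h4 : Real.tanh (ω * t) ∈ Ioo (-1 : ℝ) 1 :=
          ⟨Real.neg_one_lt_tanh _, Real.tanh_lt_one _⟩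
        rwa [← Real.artanh_lt_artanh_iff h4 hrm, Real.artanh_tanh]
      have hcosh := Real.cosh_pos (ω * t)
      rw [Real.tanh_eq_sinh_div_cosh, div_lt_iff₀ hcosh] at htanh
      have : Λ * (Real.sinh (ω * t) / ω) = Real.sinh (ω * t) / r := by
        rw [hω]; field_simp
      rw [this, sub_pos, div_lt_iff₀ hr0]
      linarith

lemma Tmax_pos {γ Λ : ℝ} (hγ : 0 < γ) (hΛ : 0 < Λ) : 0 < Tmax γ Λ :=
  (exists_generalized_sin_cos hγ hΛ).1

/-- Before time `Tmax γ Λ` the Riccati equation has a positive solution that is finite at `0`: the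
solution started at `+∞`, which vanishes at `Tmax γ Λ`, moved forward by a small time. -/
lemma exists_riccati_solution {γ Λ T : ℝ} (hγ : 0 < γ) (hΛ : 0 < Λ) (hT0 : 0 ≤ T)
    (hT : T < Tmax γ Λ) :
    ∃ φ : ℝ → ℝ, ∃ φ₀ > 0, ∀ t ∈ Icc 0 T, φ₀ ≤ φ t ∧
      HasDerivAt φ (-2 * Λ * φ t - γ * (φ t ^ 2 + 1)) t := by
  obtain ⟨-, s, c, hs, hc, hspos, hcpos⟩ := exists_generalized_sin_cos hγ hΛ
  set σ := (Tmax γ Λ - T) / 2 with hσ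
  have hmem : ∀ t ∈ Icc 0 T, t + σ ∈ Ioo 0 (Tmax γ Λ) := fun t ht =>
    ⟨by linarith [ht.1], by linarith [ht.2]⟩
  let φ : ℝ → ℝ := fun t => (c (t + σ) - Λ * s (t + σ)) / (γ * s (t + σ))
  have hder : ∀ t ∈ Icc 0 T, HasDerivAt φ (-2 * Λ * φ t - γ * (φ t ^ 2 + 1)) t := by
    intro t ht
    have h1 := hspos _ (hmem t ht)
    have hs' := (hs (t + σ)).comp_add_const t σ
    have hc' := (hc (t + σ)).comp_add_const t σ
    refine ((hc'.sub (hs'.const_mul Λ)).div (hs'.const_mul γ) (mul_pos hγ h1).ne').congr_deriv ?_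
    simp only [φ, Pi.sub_apply]
    field_simp
    ring
  have hpos : ∀ t ∈ Icc 0 T, 0 < φ t := fun t ht =>
    div_pos (hcpos _ (hmem t ht)) (mul_pos hγ (hspos _ (hmem t ht)))
  obtain ⟨t₀, ht₀, hmin⟩ := isCompact_Icc.exists_isMinOn (nonempty_Icc.2 hT0)
    (fun t ht => (hder t ht).continuousAt.continuousWithinAt)
  exact ⟨φ, φ t₀, hpos t₀ ht₀, fun t ht => ⟨hmin ht, hder t ht⟩⟩

/-! ### Comparison functions -/

namespace IsClassK

variable {α α' : ℝ → ℝ}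

lemma monotoneOn (h : IsClassK α) : MonotoneOn α (Ici 0) := h.strictMonoOn.monotoneOn

lemma mono (h : IsClassK α) {a b : ℝ} (ha : 0 ≤ a) (hab : a ≤ b) : α a ≤ α b :=
  h.monotoneOn ha (ha.trans hab) hab

lemma nonneg (h : IsClassK α) {a : ℝ} (ha : 0 ≤ a) : 0 ≤ α a := by
  simpa [h.map_zero] using h.mono le_rfl ha

protected lemma id : IsClassK fun q => q :=
  ⟨continuousOn_id, strictMonoOn_id, rfl⟩

lemma add (h : IsClassK α) (h' : IsClassK α') : IsClassK fun q => α q + α' q :=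
  ⟨h.continuousOn.add h'.continuousOn,
    fun _ ha _ hb hab => add_lt_add (h.strictMonoOn ha hb hab) (h'.strictMonoOn ha hb hab),
    by simp [h.map_zero, h'.map_zero]⟩

lemma comp (h : IsClassK α) (h' : IsClassK α') : IsClassK fun q => α (α' q) :=
  ⟨h.continuousOn.comp h'.continuousOn fun _ hq => h'.nonneg hq,
    fun _ ha _ hb hab =>
      h.strictMonoOn (h'.nonneg ha) (h'.nonneg hb) (h'.strictMonoOn ha hb hab),
    by simp [h.map_zero, h'.map_zero]⟩

lemma const_mul {k : ℝ} (hk : 0 < k) : IsClassK fun q => k * q :=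
  ⟨by fun_prop, fun _ _ _ _ hab => mul_lt_mul_of_pos_left hab hk, by simp⟩

lemma sqrt : IsClassK Real.sqrt :=
  ⟨Real.continuous_sqrt.continuousOn, fun _ ha _ _ hab => Real.sqrt_lt_sqrt ha hab, Real.sqrt_zero⟩

/-- Finitely many class `𝒦` functions have a common class `𝒦` bound. -/
lemma exists_forall_le {n : ℕ} (α : Fin n → ℝ → ℝ) (h : ∀ i, IsClassK (α i)) :
    ∃ ρ, IsClassK ρ ∧ ∀ i, ∀ q, 0 ≤ q → α i q ≤ ρ q := by
  refine ⟨fun q => q + ∑ i, α i q, ⟨?_, ?_, ?_⟩, ?_⟩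
  · exact continuousOn_id.add (continuousOn_finsetSum _ fun i _ => (h i).continuousOn)
  · intro a ha b hb hab
    exact add_lt_add_of_lt_of_le hab
      (Finset.sum_le_sum fun i _ => (h i).mono ha hab.le)
  · simp [(h _).map_zero]
  · intro i q hq
    have := Finset.single_le_sum (f := fun i => α i q) (fun i _ => (h i).nonneg hq)
      (Finset.mem_univ i)
    dsimp only at this ⊢
    linarith

end IsClassK

/-- The inverse of a class `𝒦_∞` function. -/
lemma IsClassKInf.exists_inverse {α : ℝ → ℝ} (h : IsClassKInf α) :
    ∃ ρ, IsClassK ρ ∧ ∀ r y, 0 ≤ r → α r ≤ y → r ≤ ρ y := by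
  have hK := h.toIsClassK
  let a : Ici (0 : ℝ) → Ici (0 : ℝ) := fun q => ⟨α q, hK.nonneg q.2⟩
  have hmono : StrictMono a := fun p q hpq => hK.strictMonoOn p.2 q.2 hpq
  have hsurj : Function.Surjective a := by
    rintro ⟨y, hy⟩
    obtain ⟨q, hq, hyq⟩ := h.unbounded y
    obtain ⟨p, hp, hpy⟩ := intermediate_value_Icc hq (hK.continuousOn.mono Icc_subset_Ici_self)
      (show y ∈ Icc (α 0) (α q) from ⟨by rw [hK.map_zero]; exact hy, hyq.le⟩)
    exact ⟨⟨p, hp.1⟩, Subtype.ext hpy⟩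
  let o := hmono.orderIsoOfSurjective a hsurj
  have ho : ∀ q, (o q : ℝ) = α q := fun _ => rfl
  refine ⟨IciExtend fun y => (o.symm y : ℝ), ⟨?_, ?_, ?_⟩, ?_⟩
  · rw [continuousOn_iff_continuous_domRestrict]
    exact (continuous_subtype_val.comp o.symm.continuous).congr fun y => (IciExtend_coe _ y).symm
  · intro p hp q hq hpq
    rw [IciExtend_of_mem _ hp, IciExtend_of_mem _ hq]
    exact o.symm.strictMono (Subtype.mk_lt_mk.2 hpq)
  · rw [IciExtend_of_mem _ (mem_Ici.2 le_rfl)]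
    have : o.symm ⟨0, mem_Ici.2 le_rfl⟩ = ⟨0, mem_Ici.2 le_rfl⟩ := by
      rw [OrderIso.symm_apply_eq]
      exact Subtype.ext hK.map_zero.symm
    rw [this]
  · intro r y hr hy
    have hy0 : 0 ≤ y := (hK.nonneg hr).trans hy
    rw [IciExtend_of_mem _ (show y ∈ Ici 0 from hy0)]
    exact (o.le_symm_apply (x := ⟨r, hr⟩) (y := ⟨y, hy0⟩)).2 (Subtype.mk_le_mk.2 hy)

/-- Class `𝒦ℒℒ` functions that decay exponentially in `t + j`. -/
lemma IsClassK.isClassKLL_comp_exp {ρ b : ℝ → ℝ} (hρ : IsClassK ρ) (hb : IsClassK b) {κ : ℝ}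
    (hκ : 0 < κ) :
    IsClassKLL fun q t j => ρ (b q * Real.exp (-κ * (t + j))) := by
  have key : ∀ r : ℝ, IsClassKL fun q s => ρ (b q * Real.exp (-κ * (r + s))) := by
    intro r
    have hnn : ∀ q s : ℝ, 0 ≤ q → 0 ≤ b q * Real.exp (-κ * (r + s)) := fun q s hq =>
      mul_nonneg (hb.nonneg hq) (Real.exp_pos _).le
    refine ⟨?_, ?_, ?_, ?_⟩
    · refine hρ.continuousOn.comp (t := Ici 0) (ContinuousOn.mul ?_ (by fun_prop)) ?_
      · exact hb.continuousOn.comp continuousOn_fst fun p hp => hp.1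
      · exact fun p hp => hnn _ _ hp.1
    · intro t _
      have := hρ.comp ((IsClassK.const_mul (Real.exp_pos (-κ * (r + t)))).comp hb)
      simpa only [mul_comm] using this
    · intro q hq s _ t _ hst
      refine hρ.mono (hnn q t hq) (mul_le_mul_of_nonneg_left (Real.exp_le_exp.2 ?_) (hb.nonneg hq))
      nlinarith
    · intro q hq
      have h1 : Tendsto (fun s : ℝ => b q * Real.exp (-κ * (r + s))) atTop (𝓝 (b q * 0)) := by
        refine Tendsto.const_mul _ (Real.tendsto_exp_atBot.comp ?_)
        exact (tendsto_atTop_add_const_left _ r tendsto_id).const_mul_atTop_of_neg (by linarith)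
      rw [mul_zero] at h1
      have h2 : Tendsto (fun s : ℝ => b q * Real.exp (-κ * (r + s))) atTop (𝓝[Ici 0] 0) :=
        tendsto_nhdsWithin_iff.2 ⟨h1, Eventually.of_forall fun s => hnn q s hq⟩
      have h3 := (hρ.continuousOn 0 (mem_Ici.2 le_rfl)).tendsto.comp h2
      rwa [hρ.map_zero] at h3
  refine ⟨fun r _ => key r, fun r _ => ?_⟩
  simpa only [add_comm] using key r

/-! ### Decay of the Lyapunov function between two samples -/

/-- After a reset of the error, and for less than `Tmax γ Λ`, the function
`V x + γ * φ * W e ^ 2`, with `φ` the Riccati solution, satisfies `U' ≤ -ε * U`. -/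
lemma LyapunovAssumption.exists_flow_bound {np nc : ℕ} {f : Vec np nc → Vec np nc → Vec np nc}
    (hf : Continuous fun p : Vec np nc × Vec np nc => f p.1 p.2) {V : Vec np nc → ℝ}
    {ε γ L Λ T : ℝ} (hA : LyapunovAssumption f V ε γ L) (hΛ : 0 < Λ) (hΛL : L + ε / 2 ≤ Λ)
    (hT0 : 0 ≤ T) (hT : T < Tmax γ Λ) :
    ∃ ρ, IsClassK ρ ∧ ∀ (x e : ℝ → Vec np nc) (a b : ℝ),
      (∀ t ∈ Icc a b, HasDerivWithinAt x (f (x t) (e t)) (Icc a b) t) →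
      (∀ t ∈ Icc a b, HasDerivWithinAt e (-f (x t) (e t)) (Icc a b) t) →
      e a = 0 → b - a ≤ T → ∀ t ∈ Icc a b,
        V (x t) ≤ Real.exp (-ε * (t - a)) * V (x a) ∧ ‖x t‖ + ‖e t‖ ≤ ρ (V (x a)) := by
  obtain ⟨hL, hγ, hV, hV0, W, H, αW₁, αW₂, αV₁, αV₂, hW, hW0, hH, hH0, hαW₁, hαW₂, hαV₁, hαV₂,
    hWα, hVα, hWg, hVg⟩ := hA
  obtain ⟨φ, φ₀, hφ₀, hφ⟩ := exists_riccati_solution hγ hΛ hT0 hT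
  obtain ⟨ρV, hρV, hρV'⟩ := hαV₁.exists_inverse
  obtain ⟨ρW, hρW, hρW'⟩ := hαW₁.exists_inverse
  set E := Real.exp (|ε| * T) with hE
  have hE0 : 0 < E := Real.exp_pos _
  have hk : 0 < E / (γ * φ₀) := by positivity
  refine ⟨fun y => ρV (E * y) + ρW (Real.sqrt (E / (γ * φ₀) * y)),
    (hρV.comp (IsClassK.const_mul hE0)).add
      (hρW.comp (IsClassK.sqrt.comp (IsClassK.const_mul hk))), ?_⟩
  intro x e a b hx he hea hba
  let U : ℝ → ℝ := fun t => V (x t) + γ * φ (t - a) * W (e t) ^ 2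
  have hmem : ∀ t ∈ Icc a b, t - a ∈ Icc 0 T := fun t ht =>
    ⟨by linarith [ht.1], by linarith [ht.2]⟩
  have hφder : ∀ t ∈ Icc a b, HasDerivAt (fun t => φ (t - a))
      (-2 * Λ * φ (t - a) - γ * (φ (t - a) ^ 2 + 1)) t := fun t ht =>
    (hφ _ (hmem t ht)).2.comp_sub_const t a
  have hUc : ContinuousOn U (Icc a b) := by
    have h1 : ContinuousOn x (Icc a b) := fun t ht => (hx t ht).continuousWithinAt
    have h2 : ContinuousOn e (Icc a b) := fun t ht => (he t ht).continuousWithinAt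
    have h3 : ContinuousOn (fun t => φ (t - a)) (Icc a b) := fun t ht =>
      (hφder t ht).continuousAt.continuousWithinAt
    exact (hV.continuous.comp_continuousOn h1).add
      ((continuousOn_const.mul h3).mul ((hW.continuous.comp_continuousOn h2).pow 2))
  have hslope : ∀ t ∈ Ico a b, ∀ r, -ε * U t < r →
      ∃ᶠ z in 𝓝[>] t, (z - t)⁻¹ * (U z - U t) < r := by
    intro t ht r hr
    have ht' := Ico_subset_Icc_self ht
    set w := W (e t) with hw
    set p := φ (t - a) with hp
    set h := H (x t) (e t) with hh
    have hp0 : 0 < p := hφ₀.trans_le (hφ _ (hmem t ht')).1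
    set d₁ := -ε * V (x t) - h ^ 2 + γ ^ 2 * w ^ 2 with hd₁
    set d₂ := L * w + h with hd₂
    set p' := -2 * Λ * p - γ * (p ^ 2 + 1) with hp'
    -- the square completed here is `(h - γ * p * w) ^ 2`
    have hD : d₁ + γ * p' * w ^ 2 + 2 * γ * p * w * d₂ ≤ -ε * U t := by
      have h1 : 0 ≤ (Λ - (L + ε / 2)) * (γ * p * w ^ 2) :=
        mul_nonneg (by linarith) (by positivity)
      have h2 : U t = V (x t) + γ * p * w ^ 2 := rfl
      rw [h2]
      simp only [hd₁, hd₂, hp']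
      nlinarith [sq_nonneg (h - γ * p * w)]
    have hw0 : 0 ≤ w := hW0 _
    have hq : 0 < 1 + 2 * γ * p * w := by positivity
    set κ := (r - (d₁ + γ * p' * w ^ 2 + 2 * γ * p * w * d₂)) / (2 * (1 + 2 * γ * p * w)) with hκ
    have hκ0 : 0 < κ := div_pos (by linarith) (by positivity)
    have hκr : (d₁ + κ) + γ * p' * w ^ 2 + 2 * γ * p * w * (d₂ + κ) < r := by
      have : κ * (2 * (1 + 2 * γ * p * w)) = r - (d₁ + γ * p' * w ^ 2 + 2 * γ * p * w * d₂) :=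
        div_mul_cancel₀ _ (by positivity)
      nlinarith [mul_pos hκ0 hq]
    have hnhds : Icc a b ∈ 𝓝[≥] t := Icc_mem_nhdsGE_of_mem ht
    have hVev : ∀ᶠ z in 𝓝[>] t, V (x z) ≤ V (x t) + (d₁ + κ) * (z - t) :=
      eventually_le_of_ae_inner_gradient_le volume hV (F := fun y => f y (e t))
        (R := fun y => -ε * V y - H y (e t) ^ 2 + γ ^ 2 * W (e t) ^ 2)
        (hf.comp (by fun_prop : Continuous fun y => (y, e t)))
        (((continuous_const.mul hV.continuous).sub
          ((hH.comp (by fun_prop : Continuous fun y => (y, e t))).pow 2)).add continuous_const)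
        (hVg (e t)) ((hx t ht').mono_of_mem_nhdsWithin hnhds) (by
          simp only [hd₁, hh, hw]; linarith)
    have hWev : ∀ᶠ z in 𝓝[>] t, W (e z) ≤ w + (d₂ + κ) * (z - t) :=
      eventually_le_of_ae_inner_gradient_le volume hW (F := fun y => -f (x t) y)
        (R := fun y => L * W y + H (x t) y)
        (hf.comp (by fun_prop : Continuous fun y => (x t, y))).neg
        ((continuous_const.mul hW.continuous).add
          (hH.comp (by fun_prop : Continuous fun y => (x t, y))))
        (hWg (x t)) ((he t ht').mono_of_mem_nhdsWithin hnhds) (by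
          simp only [hd₂, hh, hw]; linarith)
    -- a differentiable majorant of `U` to the right of `t`
    let M : ℝ → ℝ := fun z =>
      V (x t) + (d₁ + κ) * (z - t) + γ * φ (z - a) * (w + (d₂ + κ) * (z - t)) ^ 2
    have hMt : M t = U t := by simp [M, U, hw]
    have hMder : HasDerivAt M ((d₁ + κ) + γ * p' * w ^ 2 + 2 * γ * p * w * (d₂ + κ)) t := by
      have h1 : ∀ q k : ℝ, HasDerivAt (fun z => q + k * (z - t)) k t := fun q k => by
        simpa using (((hasDerivAt_id t).sub_const t).const_mul k).const_add q
      refine ((h1 _ _).add (((hφder t ht').const_mul γ).mul ((h1 _ _).pow 2))).congr_deriv ?_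
      simp only [Pi.pow_apply, sub_self, mul_zero, add_zero, ← hp]
      push_cast
      ring
    have hMev := hMder.hasDerivWithinAt (s := Ioi t) |>.limsup_slope_le' self_notMem_Ioi hκr
    have hIcc : ∀ᶠ z in 𝓝[>] t, z ∈ Icc a b :=
      nhdsWithin_mono t Ioi_subset_Ici_self hnhds
    refine Eventually.frequently ?_
    filter_upwards [hVev, hWev, hMev, hIcc, self_mem_nhdsWithin] with z h1 h2 h3 h4 h5
    refine lt_of_le_of_lt ?_ h3
    rw [slope_def_module, hMt, smul_eq_mul]
    have hz : 0 < (z - t)⁻¹ := inv_pos.2 (sub_pos.2 h5)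
    refine mul_le_mul_of_nonneg_left (sub_le_sub_right ?_ _) hz.le
    have h6 : 0 < φ (z - a) := hφ₀.trans_le (hφ _ (hmem z h4)).1
    exact add_le_add h1 (mul_le_mul_of_nonneg_left
      (pow_le_pow_left₀ (hW0 _) h2 2) (by positivity))
  have hW00 : W 0 = 0 := by
    refine le_antisymm ?_ (hW0 0)
    simpa [hαW₂.map_zero] using (hWα 0).2
  have hUa : U a = V (x a) := by simp [U, hea, hW00]
  intro t ht
  have hgr := le_gronwallBound_of_liminf_deriv_right_le hUc hslope le_rfl
    (K := -ε) (ε := 0) (fun z _ => by simp) t ht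
  rw [gronwallBound_ε0, hUa, mul_comm] at hgr
  have hp0 := (hφ _ (hmem t ht)).1
  have hVa := hV0 (x a)
  have hUt : U t = V (x t) + γ * φ (t - a) * W (e t) ^ 2 := rfl
  have hWt : γ * φ₀ * W (e t) ^ 2 ≤ γ * φ (t - a) * W (e t) ^ 2 := by gcongr
  have hWt0 : 0 ≤ γ * φ₀ * W (e t) ^ 2 := by positivity
  have hexp : Real.exp (-ε * (t - a)) * V (x a) ≤ E * V (x a) := by
    refine mul_le_mul_of_nonneg_right (Real.exp_le_exp.2 ?_) hVa
    calc -ε * (t - a) ≤ |ε| * (t - a) :=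
          mul_le_mul_of_nonneg_right (neg_le_abs ε) (hmem t ht).1
      _ ≤ |ε| * T := mul_le_mul_of_nonneg_left (hmem t ht).2 (abs_nonneg ε)
  refine ⟨by linarith, add_le_add (hρV' _ _ (norm_nonneg _) ?_) (hρW' _ _ (norm_nonneg _) ?_)⟩
  · linarith [(hVα (x t)).1, hV0 (x t)]
  · refine (hWα (e t)).1.trans (Real.le_sqrt_of_sq_le ?_)
    rw [div_mul_eq_mul_div, le_div_iff₀ (by positivity)]
    linarith [hV0 (x t)]

/-! ### The sampling mechanism -/

lemma refValue_le {np nc m : ℕ} (hm : 0 < m) {V : Vec np nc → ℝ} {c : EReal} (hc : 0 < c)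
    {x : Vec np nc} {η : EuclideanSpace ℝ (Fin (m - 1))} {B : ℝ} (hV : V x ≤ B)
    (hη : ∀ k, η k ≤ B) : refValue m V c x η ≤ B := by
  have hm' : (0 : ℝ) < m := by exact_mod_cast hm
  have havg : (1 / m : ℝ) * (V x + ∑ k, η k) ≤ B := by
    have h1 : ∑ k, η k ≤ ((m : ℝ) - 1) * B := by
      have := Finset.sum_le_card_nsmul Finset.univ (fun k => η k) B fun k _ => hη k
      rw [Finset.card_univ, Fintype.card_fin, nsmul_eq_mul, Nat.cast_sub hm] at this
      simpa using this
    rw [one_div, inv_mul_le_iff₀ hm']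
    linarith
  refine le_trans ?_ havg
  rw [← EReal.toReal_coe ((1 / m : ℝ) * (V x + ∑ k, η k))]
  refine EReal.toReal_le_toReal (min_le_right _ _) ?_ (EReal.coe_ne_top _)
  exact (lt_min ((EReal.bot_lt_zero).trans hc) (EReal.bot_lt_coe _)).ne'

/-- A positive candidate interval `h` is admissible for its parameter set and realizes the
reference decay `exp (-ε * h) * v ≤ exp (-εref * h) * C`. -/
lemma candidate_spec {δ εref v C ε γ L : ℝ} (hv : 0 ≤ v)
    (hpos : 0 < candidate δ εref v C ε γ L) :
    candidate δ εref v C ε γ L ≤ δ * Tmax γ (max (L + ε / 2) (1 - δ)) ∧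
      Real.exp (-ε * candidate δ εref v C ε γ L) * v ≤
        Real.exp (-εref * candidate δ εref v C ε γ L) * C := by
  set h := candidate δ εref v C ε γ L with hh
  have key : 0 < v → 0 < C → (-ε + εref) * h ≤ Real.log C - Real.log v →
      Real.exp (-ε * h) * v ≤ Real.exp (-εref * h) * C := by
    intro hv0 hC0 hle
    rw [← Real.exp_log hv0, ← Real.exp_log hC0, ← Real.exp_add, ← Real.exp_add]
    exact Real.exp_le_exp.2 (by linarith)
  simp only [candidate] at hh
  split_ifs at hh with h1 h2 h3 h4 h5 h6
  · refine ⟨hh.le, ?_⟩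
    rw [h3, mul_zero]
    exact mul_nonneg (Real.exp_pos _).le (hv.trans h1)
  · have hv0 : 0 < v := lt_of_le_of_ne hv (Ne.symm h3)
    refine ⟨hh.le.trans (min_le_left _ _), key hv0 (hv0.trans_le h1) ?_⟩
    have := hh.le.trans (min_le_right _ _)
    rwa [le_div_iff₀ h2, mul_comm] at this
  · refine ⟨hh.le, mul_le_mul (Real.exp_le_exp.2 ?_) h1 hv (Real.exp_pos _).le⟩
    nlinarith
  · exact absurd hh hpos.ne'
  · exact absurd hh hpos.ne'
  · refine ⟨hh.le, key (by linarith) (by linarith) ?_⟩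
    rw [← hh, div_lt_iff_of_neg (by linarith)] at h6
    linarith
  · exact absurd hh hpos.ne'

lemma foldl_max_spec {ι : Type*} (h : ι → ℝ) (l : List ι) (a : ℝ) :
    a ≤ l.foldl (fun b i => if b < h i then h i else b) a ∧
      (l.foldl (fun b i => if b < h i then h i else b) a = a ∨
        ∃ i, l.foldl (fun b i => if b < h i then h i else b) a = h i) := by
  induction l generalizing a with
  | nil => simp
  | cons i l ih =>
    rw [List.foldl_cons]
    obtain ⟨h1, h2⟩ := ih (if a < h i then h i else a)
    refine ⟨le_trans ?_ h1, ?_⟩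
    · split_ifs with hlt
      exacts [hlt.le, le_rfl]
    · rcases h2 with h2 | h2
      · split_ifs at h2 ⊢ with hlt
        exacts [Or.inr ⟨i, h2⟩, Or.inl h2]
      · exact Or.inr h2

/-- The value of `Λ` at which `Tmax` is evaluated for each parameter set: the fall-back set, with
index `0`, needs no safeguard because `L 0 + ε 0 / 2 > 0`. -/
noncomputable def comparisonRate (δ : ℝ) {N : ℕ} (ε L : Fin (N + 1) → ℝ) : Fin (N + 1) → ℝ :=
  Fin.cons (L 0 + ε 0 / 2) fun i => max (L i.succ + ε i.succ / 2) (1 - δ)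

/-- The interval selected by the trigger rule is admissible for one of the parameter sets, and for
that set the guaranteed value of `V` at the next sample is a fixed factor below every bound on the
last `m` values. -/
lemma trigger_spec {np nc m : ℕ} (hm : 0 < m) {V : Vec np nc → ℝ} {c : EReal} (hc : 0 < c)
    {δ εref : ℝ} (hεref : 0 < εref) {N : ℕ} {ε γ L : Fin (N + 1) → ℝ}
    (htmin : 0 < δ * Tmax (γ 0) (L 0 + ε 0 / 2))
    {x : Vec np nc} (hV : 0 ≤ V x) (η : EuclideanSpace ℝ (Fin (m - 1))) :
    δ * Tmax (γ 0) (L 0 + ε 0 / 2) ≤ trigger m V c δ εref ε γ L x η ∧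
    ∃ i, trigger m V c δ εref ε γ L x η ≤ δ * Tmax (γ i) (comparisonRate δ ε L i) ∧
      ∀ B, V x ≤ B → (∀ k, η k ≤ B) →
        Real.exp (-ε i * trigger m V c δ εref ε γ L x η) * V x ≤
          Real.exp (-(min (ε 0) εref * (δ * Tmax (γ 0) (L 0 + ε 0 / 2)))) * B := by
  obtain ⟨hle, hcase⟩ := foldl_max_spec (fun i : Fin N =>
    candidate δ εref (V x) (refValue m V c x η) (ε i.succ) (γ i.succ) (L i.succ))
    (List.finRange N) (δ * Tmax (γ 0) (L 0 + ε 0 / 2))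
  change δ * Tmax (γ 0) (L 0 + ε 0 / 2) ≤ trigger m V c δ εref ε γ L x η at hle
  set tmin := δ * Tmax (γ 0) (L 0 + ε 0 / 2) with htm
  set h := trigger m V c δ εref ε γ L x η with hh
  refine ⟨hle, ?_⟩
  rcases hcase with heq | ⟨i, heq⟩
  · change h = tmin at heq
    refine ⟨0, by rw [heq, htm]; rfl, fun B hB _ => ?_⟩
    refine mul_le_mul (Real.exp_le_exp.2 ?_) hB hV (Real.exp_pos _).le
    rw [heq]
    nlinarith [min_le_left (ε 0) εref]
  · change h = _ at heq
    have hspec := candidate_spec (δ := δ) (εref := εref) (C := refValue m V c x η)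
      (ε := ε i.succ) (γ := γ i.succ) (L := L i.succ) hV (by rw [← heq]; linarith)
    rw [← heq] at hspec
    refine ⟨i.succ, hspec.1, fun B hB hη => ?_⟩
    have hB0 : 0 ≤ B := hV.trans hB
    calc _ ≤ Real.exp (-εref * h) * refValue m V c x η := hspec.2
      _ ≤ Real.exp (-εref * h) * B :=
        mul_le_mul_of_nonneg_left (refValue_le hm hc hB hη) (Real.exp_pos _).le
      _ ≤ _ := by
        refine mul_le_mul_of_nonneg_right (Real.exp_le_exp.2 ?_) hB0
        have h1 := mul_le_mul_of_nonneg_right (min_le_right (ε 0) εref) htmin.le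
        have h2 := mul_le_mul_of_nonneg_left hle hεref.le
        linarith

/-! ### Hybrid time domains and solutions -/

namespace IsHybridTimeDomain

variable {T : Set (ℝ × ℕ)}

lemma mem_of_mem_Icc (hT : IsHybridTimeDomain T) {a b s : ℝ} {j : ℕ} (ha : (a, j) ∈ T)
    (hb : (b, j) ∈ T) (hs : s ∈ Icc a b) : (s, j) ∈ T := by
  obtain ⟨J, τ, -, -, hJ⟩ := hT.truncation _ hb
  have ha0 := hT.nonneg _ ha
  have h1 : (a, j) ∈ T ∩ (Icc 0 b ×ˢ Iic j) := ⟨ha, ⟨ha0, hs.1.trans hs.2⟩, mem_Iic.2 le_rfl⟩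
  have h2 : (b, j) ∈ T ∩ (Icc 0 b ×ˢ Iic j) := ⟨hb, ⟨hT.nonneg _ hb, le_rfl⟩, mem_Iic.2 le_rfl⟩
  rw [hJ] at h1 h2
  have h3 : (s, j) ∈ {p : ℝ × ℕ | p.2 < J ∧ τ p.2 ≤ p.1 ∧ p.1 ≤ τ (p.2 + 1)} :=
    ⟨h1.1, h1.2.1.trans hs.1, hs.2.trans h2.2.2⟩
  rw [← hJ] at h3
  exact h3.1

lemma zero_mem (hT : IsHybridTimeDomain T) : ((0 : ℝ), 0) ∈ T := by
  obtain ⟨p, hp⟩ := hT.nonempty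
  obtain ⟨J, τ, h0, hmono, hJ⟩ := hT.truncation p hp
  have h1 : p ∈ T ∩ (Icc 0 p.1 ×ˢ Iic p.2) := ⟨hp, ⟨hT.nonneg _ hp, le_rfl⟩, mem_Iic.2 le_rfl⟩
  rw [hJ] at h1
  have hJ0 : 0 < J := (Nat.zero_le _).trans_lt h1.1
  have h3 : ((0 : ℝ), 0) ∈ {p : ℝ × ℕ | p.2 < J ∧ τ p.2 ≤ p.1 ∧ p.1 ≤ τ (p.2 + 1)} :=
    ⟨hJ0, h0.le, by simpa [h0] using hmono 0 hJ0⟩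
  rw [← hJ] at h3
  exact h3.1

/-- Every point after the first jump is preceded by a jump into its own slice. -/
lemma exists_jump (hT : IsHybridTimeDomain T) {t : ℝ} {j : ℕ} (ht : (t, j + 1) ∈ T) :
    ∃ a ≤ t, IsSamplingInstant T j a := by
  obtain ⟨J, τ, -, hmono, hJ⟩ := hT.truncation _ ht
  have h1 : (t, j + 1) ∈ T ∩ (Icc 0 t ×ˢ Iic (j + 1)) :=
    ⟨ht, ⟨hT.nonneg _ ht, le_rfl⟩, mem_Iic.2 le_rfl⟩
  rw [hJ] at h1
  obtain ⟨h1, h2, h3⟩ := h1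
  dsimp only at h1 h2 h3
  have h4 : (τ (j + 1), j) ∈ {p : ℝ × ℕ | p.2 < J ∧ τ p.2 ≤ p.1 ∧ p.1 ≤ τ (p.2 + 1)} :=
    ⟨by simp; omega, hmono j (by omega), le_rfl⟩
  have h5 : (τ (j + 1), j + 1) ∈ {p : ℝ × ℕ | p.2 < J ∧ τ p.2 ≤ p.1 ∧ p.1 ≤ τ (p.2 + 1)} :=
    ⟨h1, le_rfl, hmono (j + 1) h1⟩
  rw [← hJ] at h4 h5
  exact ⟨τ (j + 1), h2, h4.1, h5.1⟩

lemma le_of_isSamplingInstant (hT : IsHybridTimeDomain T) {t t' : ℝ} {j : ℕ}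
    (ht : IsSamplingInstant T j t) (ht' : (t', j + 1) ∈ T) : t ≤ t' := by
  by_contra! hlt
  obtain ⟨J, τ, -, -, hJ⟩ := hT.truncation _ ht.2
  have h0 := hT.nonneg _ ht.1
  have h1 : (t, j) ∈ T ∩ (Icc 0 t ×ˢ Iic (j + 1)) :=
    ⟨ht.1, ⟨h0, le_rfl⟩, mem_Iic.2 (Nat.le_succ j)⟩
  have h2 : (t', j + 1) ∈ T ∩ (Icc 0 t ×ˢ Iic (j + 1)) :=
    ⟨ht', ⟨hT.nonneg _ ht', hlt.le⟩, mem_Iic.2 le_rfl⟩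
  rw [hJ] at h1 h2
  exact absurd (h1.2.2.trans h2.2.1) (not_le.2 hlt)

end IsHybridTimeDomain

section Flow

variable {np nc nη : ℕ} {f : Vec np nc → Vec np nc → Vec np nc}
  {S : EuclideanSpace ℝ (Fin nη) → Vec np nc → EuclideanSpace ℝ (Fin nη)}
  {Γ : Vec np nc → EuclideanSpace ℝ (Fin nη) → ℝ} {T : Set (ℝ × ℕ)}
  {ξ : ℝ → ℕ → State np nc nη}

lemma eq_of_hasDerivWithinAt_zero {E : Type*} [NormedAddCommGroup E] [NormedSpace ℝ E]
    {g : ℝ → E} {a b : ℝ} (h : ∀ t ∈ Icc a b, HasDerivWithinAt g 0 (Icc a b) t) :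
    ∀ t ∈ Icc a b, g t = g a :=
  constant_of_has_deriv_right_zero (fun t ht => (h t ht).continuousWithinAt) fun t ht =>
    (h t (Ico_subset_Icc_self ht)).mono_of_mem_nhdsWithin (Icc_mem_nhdsGE_of_mem ht)

/-- Along a flow interval the solution is a classical one, `η` and `s` are constant, and the timer
measures the elapsed time and does not exceed `s`. -/
lemma IsSolution.flow_on_Icc (hf : Continuous fun p : Vec np nc × Vec np nc => f p.1 p.2)
    (hsol : IsSolution (stcSystem f S Γ) T ξ) {a b : ℝ} {j : ℕ} (hab : a ≤ b)
    (ha : (a, j) ∈ T) (hb : (b, j) ∈ T) :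
    (∀ t ∈ Icc a b, HasDerivWithinAt (fun t => (ξ t j).x) (f (ξ t j).x (ξ t j).e) (Icc a b) t) ∧
    (∀ t ∈ Icc a b, HasDerivWithinAt (fun t => (ξ t j).e) (-f (ξ t j).x (ξ t j).e) (Icc a b) t) ∧
    (∀ t ∈ Icc a b, (ξ t j).eta = (ξ a j).eta ∧ (ξ t j).timer = (ξ a j).timer + (t - a) ∧
      (ξ t j).interval = (ξ a j).interval) ∧
    (a < b → (ξ a j).timer + (b - a) ≤ (ξ a j).interval) := by
  have hmem : ∀ t ∈ Icc a b, (t, j) ∈ T := fun t ht =>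
    hsol.timeDomain.mem_of_mem_Icc ha hb ht
  have hac := hsol.absolutelyContinuous j a b ha hb
  have hcont : ContinuousOn (fun t => ξ t j) (Icc a b) := by
    simpa [uIcc_of_le hab] using hac.continuousOn
  have hFc : Continuous (stcSystem f S Γ).flowMap := by
    have h1 : Continuous fun ξ : State np nc nη => f ξ.x ξ.e :=
      hf.comp (f := fun ξ : State np nc nη => (ξ.1, ξ.2.1)) (by fun_prop)
    exact h1.prodMk (h1.neg.prodMk continuous_const)
  have hder := hac.hasDerivWithinAt_of_ae (F := fun t => (stcSystem f S Γ).flowMap (ξ t j)) hab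
    (hFc.comp_continuousOn hcont) (by
      filter_upwards [hsol.flow j] with t h ht
      exact (h (hmem t ht)).2.mono hmem)
  have hx : ∀ t ∈ Icc a b,
      HasDerivWithinAt (fun t => (ξ t j).x) (f (ξ t j).x (ξ t j).e) (Icc a b) t := fun t ht =>
    (hder t ht).fst
  have he : ∀ t ∈ Icc a b,
      HasDerivWithinAt (fun t => (ξ t j).e) (-f (ξ t j).x (ξ t j).e) (Icc a b) t := fun t ht =>
    (hder t ht).snd.fst
  have heta : ∀ t ∈ Icc a b, HasDerivWithinAt (fun t => (ξ t j).eta) 0 (Icc a b) t :=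
    fun t ht => (hder t ht).snd.snd.fst
  have htimer : ∀ t ∈ Icc a b, HasDerivWithinAt (fun t => (ξ t j).timer) 1 (Icc a b) t :=
    fun t ht => (hder t ht).snd.snd.snd.fst
  have hint : ∀ t ∈ Icc a b, HasDerivWithinAt (fun t => (ξ t j).interval) 0 (Icc a b) t :=
    fun t ht => (hder t ht).snd.snd.snd.snd
  have htimer' : ∀ t ∈ Icc a b, HasDerivWithinAt (fun t => (ξ t j).timer - t) 0 (Icc a b) t :=
    fun t ht => ((htimer t ht).sub (hasDerivWithinAt_id t _)).congr_deriv (sub_self _)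
  have hval : ∀ t ∈ Icc a b, (ξ t j).eta = (ξ a j).eta ∧
      (ξ t j).timer = (ξ a j).timer + (t - a) ∧ (ξ t j).interval = (ξ a j).interval :=
    fun t ht => ⟨eq_of_hasDerivWithinAt_zero heta t ht,
      by linarith [eq_of_hasDerivWithinAt_zero htimer' t ht],
      eq_of_hasDerivWithinAt_zero hint t ht⟩
  refine ⟨hx, he, hval, fun hlt => ?_⟩
  by_contra! hcon
  -- otherwise the flow condition fails on a nontrivial interval ending at `b`
  set d := max a (a + ((ξ a j).interval - (ξ a j).timer)) with hd
  have hdb : d < b := max_lt hlt (by linarith)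
  have hflow := hsol.flow j
  have hdense := (Measure.dense_of_ae hflow).exists_mem_open isOpen_Ioo (nonempty_Ioo.2 hdb)
  obtain ⟨t, ht, htd⟩ := hdense
  have htab : t ∈ Icc a b := ⟨(le_max_left _ _).trans htd.1.le, htd.2.le⟩
  have h1 : (ξ t j).timer ≤ (ξ t j).interval := (ht (hmem t htab)).1
  obtain ⟨-, h2, h3⟩ := hval t htab
  have h4 := (le_max_right _ _).trans_lt htd.1
  linarith

/-- The flow interval that follows a jump. -/
lemma IsSolution.flow_after_jump (hf : Continuous fun p : Vec np nc × Vec np nc => f p.1 p.2)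
    (hsol : IsSolution (stcSystem f S Γ) T ξ) {a b : ℝ} {j : ℕ}
    (hΓ : 0 ≤ Γ (ξ a j).x (ξ a j).eta) (ha : IsSamplingInstant T j a) (hb : (b, j + 1) ∈ T) :
    a ≤ b ∧ (ξ a (j + 1)).x = (ξ a j).x ∧ (ξ a (j + 1)).e = 0 ∧
    (∀ t ∈ Icc a b, HasDerivWithinAt (fun t => (ξ t (j + 1)).x)
      (f (ξ t (j + 1)).x (ξ t (j + 1)).e) (Icc a b) t) ∧
    (∀ t ∈ Icc a b, HasDerivWithinAt (fun t => (ξ t (j + 1)).e)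
      (-f (ξ t (j + 1)).x (ξ t (j + 1)).e) (Icc a b) t) ∧
    (ξ b (j + 1)).eta = S (ξ a j).eta (ξ a j).x ∧
    b - a ≤ Γ (ξ a j).x (ξ a j).eta ∧
    ((b, j + 2) ∈ T → b - a = Γ (ξ a j).x (ξ a j).eta) := by
  have hab := hsol.timeDomain.le_of_isSamplingInstant ha hb
  obtain ⟨hx, he, hval, hle⟩ := hsol.flow_on_Icc hf hab ha.2 hb
  have hjump := (hsol.jump a j ha.1 ha.2).2
  have h1 : (ξ a (j + 1)).x = (ξ a j).x := by rw [hjump]; rfl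
  have h2 : (ξ a (j + 1)).e = 0 := by rw [hjump]; rfl
  have h3 : (ξ a (j + 1)).eta = S (ξ a j).eta (ξ a j).x := by rw [hjump]; rfl
  have h4 : (ξ a (j + 1)).timer = 0 := by rw [hjump]; rfl
  have h5 : (ξ a (j + 1)).interval = Γ (ξ a j).x (ξ a j).eta := by rw [hjump]; rfl
  obtain ⟨h6, h7, h8⟩ := hval b ⟨hab, le_rfl⟩
  refine ⟨hab, h1, h2, hx, he, h6.trans h3, ?_, fun hb' => ?_⟩
  · rcases hab.eq_or_lt with rfl | hlt
    · simpa using hΓ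
    · have := hle hlt
      rwa [h4, h5, zero_add] at this
  · have h9 : (ξ b (j + 1)).timer = (ξ b (j + 1)).interval := (hsol.jump b (j + 1) hb hb').1
    rwa [h7, h8, h4, h5, zero_add] at h9

/-- Since `s = τ` initially, a solution cannot flow before its first jump. -/
lemma IsSolution.eq_zero_of_mem_zero
    (hf : Continuous fun p : Vec np nc × Vec np nc => f p.1 p.2)
    (hsol : IsSolution (stcSystem f S Γ) T ξ) {R : Set (Vec np nc)} (hinit : IsInitial R (ξ 0 0))
    {t : ℝ} (ht : (t, 0) ∈ T) : t = 0 := by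
  have h0 := hsol.timeDomain.nonneg _ ht
  by_contra hne
  have hlt : 0 < t := lt_of_le_of_ne h0 (Ne.symm hne)
  have := (hsol.flow_on_Icc hf h0 hsol.timeDomain.zero_mem ht).2.2.2 hlt
  rw [hinit.2.2] at this
  linarith

end Flow

/-! ### Contraction of the window of past values -/

/-- The last `m` values of `V`, stored in `V x` and `η`, are bounded by `B`, with weights that grow
exponentially with the age of the value (`η k` has age `m - 1 - k`). With these weights one step of
a recursion `v⁺ ≤ exp (-k * m) * max` contracts the whole window by `exp (-k)`. -/
def WindowBound {np nc : ℕ} (m : ℕ) (V : Vec np nc → ℝ) (k B : ℝ) (x : Vec np nc)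
    (η : EuclideanSpace ℝ (Fin (m - 1))) : Prop :=
  V x ≤ B ∧ ∀ i, |η i| ≤ B * Real.exp (k * (m - 1 - (i : ℕ)))

section Window

variable {np nc m : ℕ} {V : Vec np nc → ℝ} {k B : ℝ} {x x' : Vec np nc}
  {η : EuclideanSpace ℝ (Fin (m - 1))}

lemma age_nonneg (i : Fin (m - 1)) : (0 : ℝ) ≤ m - 1 - (i : ℕ) := by
  have : (i : ℕ) + 1 ≤ m := by have := i.2; omega
  have : ((i : ℕ) : ℝ) + 1 ≤ m := by exact_mod_cast this
  linarith

lemma WindowBound.abs_eta_le (hk : 0 ≤ k) (hB : 0 ≤ B) (h : WindowBound m V k B x η)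
    (i : Fin (m - 1)) : |η i| ≤ B * Real.exp (k * (m - 1)) := by
  refine (h.2 i).trans (mul_le_mul_of_nonneg_left (Real.exp_le_exp.2 ?_) hB)
  refine mul_le_mul_of_nonneg_left ?_ hk
  have : (0 : ℝ) ≤ (i : ℕ) := Nat.cast_nonneg _
  linarith

lemma le_mul_exp (hm : 0 < m) (hk : 0 ≤ k) (hB : 0 ≤ B) : B ≤ B * Real.exp (k * (m - 1)) := by
  have hm' : (1 : ℝ) ≤ m := by exact_mod_cast hm
  exact le_mul_of_one_le_right hB (Real.one_le_exp (mul_nonneg hk (by linarith)))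

lemma WindowBound.step (hV : ∀ x, 0 ≤ V x) (h : WindowBound m V k B x η)
    (hx' : V x' ≤ Real.exp (-(k * m)) * (B * Real.exp (k * (m - 1)))) :
    WindowBound m V k (B * Real.exp (-k)) x' (etaUpdate m V η x) := by
  constructor
  · refine hx'.trans (le_of_eq ?_)
    rw [mul_left_comm, ← Real.exp_add]
    ring_nf
  · intro i
    rw [mul_assoc, ← Real.exp_add]
    by_cases hi : i.val + 1 < m - 1
    · have h1 : etaUpdate m V η x i = η ⟨i.val + 1, hi⟩ := by simp [etaUpdate, hi]
      rw [h1]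
      refine (h.2 _).trans (le_of_eq ?_)
      push_cast
      ring_nf
    · have h1 : etaUpdate m V η x i = V x := by simp [etaUpdate, hi]
      rw [h1, abs_of_nonneg (hV x)]
      have h2 : m = i.val + 2 := by have := i.2; omega
      have h3 : (m : ℝ) = (i : ℕ) + 2 := by exact_mod_cast h2
      refine h.1.trans (le_of_eq ?_)
      rw [h3, show -k + k * ((i : ℕ) + 2 - 1 - (i : ℕ) : ℝ) = 0 by ring, Real.exp_zero, mul_one]

lemma WindowBound.norm_etaUpdate_le (hm : 0 < m) (hk : 0 ≤ k) (hB : 0 ≤ B) (hV : ∀ x, 0 ≤ V x)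
    (h : WindowBound m V k B x η) :
    ‖etaUpdate m V η x‖ ≤ m * (B * Real.exp (k * (m - 1))) := by
  have hM : 0 ≤ B * Real.exp (k * (m - 1)) := by positivity
  have h1 : ∀ i, |etaUpdate m V η x i| ≤ B * Real.exp (k * (m - 1)) := by
    intro i
    by_cases hi : i.val + 1 < m - 1
    · have h1 : etaUpdate m V η x i = η ⟨i.val + 1, hi⟩ := by simp [etaUpdate, hi]
      rw [h1]
      exact h.abs_eta_le hk hB _
    · have h1 : etaUpdate m V η x i = V x := by simp [etaUpdate, hi]
      rw [h1, abs_of_nonneg (hV x)]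
      exact h.1.trans (le_mul_exp hm hk hB)
  have hm' : (1 : ℝ) ≤ m := by exact_mod_cast hm
  rw [EuclideanSpace.norm_eq]
  refine Real.sqrt_le_iff.2 ⟨by positivity, ?_⟩
  calc ∑ i, ‖etaUpdate m V η x i‖ ^ 2
      ≤ ∑ _i : Fin (m - 1), (B * Real.exp (k * (m - 1))) ^ 2 :=
        Finset.sum_le_sum fun i _ => pow_le_pow_left₀ (norm_nonneg _) (h1 i) 2
    _ = ((m : ℝ) - 1) * (B * Real.exp (k * (m - 1))) ^ 2 := by
        rw [Finset.sum_const, Finset.card_univ, Fintype.card_fin, nsmul_eq_mul, Nat.cast_sub hm,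
          Nat.cast_one]
    _ ≤ (m : ℝ) ^ 2 * (B * Real.exp (k * (m - 1))) ^ 2 := by
        refine mul_le_mul_of_nonneg_right ?_ (sq_nonneg _)
        nlinarith
    _ = _ := by ring

lemma windowBound_of_norm_le (hk : 0 ≤ k) (hB : 0 ≤ B) (hV : V x ≤ B) (hη : ‖η‖ ≤ B) :
    WindowBound m V k B x η :=
  ⟨hV, fun i => ((PiLp.norm_apply_le η i).trans hη).trans
    (le_mul_of_one_le_right hB (Real.one_le_exp (mul_nonneg hk (age_nonneg i))))⟩

end Window

lemma State.stackedNorm_le {np nc nη : ℕ} (ξ : State np nc nη) :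
    ξ.stackedNorm ≤ ‖ξ.x‖ + ‖ξ.e‖ + ‖ξ.eta‖ := by
  refine Real.sqrt_le_iff.2 ⟨by positivity, ?_⟩
  nlinarith [mul_nonneg (norm_nonneg ξ.x) (norm_nonneg ξ.e),
    mul_nonneg (norm_nonneg ξ.x) (norm_nonneg ξ.eta),
    mul_nonneg (norm_nonneg ξ.e) (norm_nonneg ξ.eta)]

lemma State.norm_x_le_stackedNorm {np nc nη : ℕ} (ξ : State np nc nη) : ‖ξ.x‖ ≤ ξ.stackedNorm :=
  Real.le_sqrt_of_sq_le (by nlinarith [sq_nonneg ‖ξ.e‖, sq_nonneg ‖ξ.eta‖])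

lemma State.norm_eta_le_stackedNorm {np nc nη : ℕ} (ξ : State np nc nη) :
    ‖ξ.eta‖ ≤ ξ.stackedNorm :=
  Real.le_sqrt_of_sq_le (by nlinarith [sq_nonneg ‖ξ.e‖, sq_nonneg ‖ξ.x‖])

/-! ### Stability of the sampled-data loop -/

section Stability

variable {np nc : ℕ} {f : Vec np nc → Vec np nc → Vec np nc} {V : Vec np nc → ℝ}
  {N m : ℕ} {ε γ L : Fin (N + 1) → ℝ} {c : EReal} {δ εref : ℝ}

lemma comparisonRate_pos (hL : ∀ i, 0 < L i) (hε : 0 < ε 0) (hδ1 : δ < 1) (i : Fin (N + 1)) :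
    0 < comparisonRate δ ε L i := by
  refine Fin.cases ?_ (fun i => ?_) i
  · simp only [comparisonRate, Fin.cons_zero]
    linarith [hL 0]
  · simp only [comparisonRate, Fin.cons_succ]
    exact lt_max_of_lt_right (by linarith)

lemma le_comparisonRate (i : Fin (N + 1)) : L i + ε i / 2 ≤ comparisonRate δ ε L i := by
  refine Fin.cases ?_ (fun i => ?_) i
  · simp [comparisonRate]
  · simp only [comparisonRate, Fin.cons_succ]
    exact le_max_left _ _

lemma IsSolution.le_sub_of_isSamplingInstant
    (hf : Continuous fun p : Vec np nc × Vec np nc => f p.1 p.2) (hm : 0 < m) (hc : 0 < c)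
    (hεref : 0 < εref) (htmin : 0 < δ * Tmax (γ 0) (L 0 + ε 0 / 2)) (hV : ∀ x, 0 ≤ V x)
    {T : Set (ℝ × ℕ)} {ξ : ℝ → ℕ → State np nc (m - 1)}
    (hsol : IsSolution (stcSystem f (etaUpdate m V) (trigger m V c δ εref ε γ L)) T ξ)
    {j : ℕ} {t t' : ℝ} (ht : IsSamplingInstant T j t) (ht' : IsSamplingInstant T (j + 1) t') :
    δ * Tmax (γ 0) (L 0 + ε 0 / 2) ≤ t' - t := by
  have h := (trigger_spec hm hc hεref (ε := ε) htmin (hV (ξ t j).x) (ξ t j).eta).1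
  obtain ⟨-, -, -, -, -, -, -, h'⟩ :=
    hsol.flow_after_jump hf (htmin.le.trans h) ht ht'.1
  rw [h' ht'.2]
  exact h

/-- The window of sampled values of `V` contracts at each sample, and between samples the state is
bounded by the window. -/
theorem isUGAS_stcSystem (hf : Continuous fun p : Vec np nc × Vec np nc => f p.1 p.2)
    (hA : ∀ i, LyapunovAssumption f V (ε i) (γ i) (L i)) (hε : 0 < ε 0) (hm : 0 < m)
    (hc : 0 < c) (hδ : δ ∈ Ioo (0 : ℝ) 1) (hεref : 0 < εref) :
    IsUGAS (stcSystem f (etaUpdate m V) (trigger m V c δ εref ε γ L)) := by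
  have hV : ∀ x, 0 ≤ V x := (hA 0).2.2.2.1
  have hΛ := comparisonRate_pos (fun i => (hA i).1) hε hδ.2
  set θ : Fin (N + 1) → ℝ := fun i => δ * Tmax (γ i) (comparisonRate δ ε L i) with hθ
  have hTm : ∀ i, 0 < Tmax (γ i) (comparisonRate δ ε L i) := fun i =>
    Tmax_pos (hA i).2.1 (hΛ i)
  have hθ0 : ∀ i, 0 < θ i := fun i => mul_pos hδ.1 (hTm i)
  have htmin : 0 < δ * Tmax (γ 0) (L 0 + ε 0 / 2) := hθ0 0
  set hmax := ∑ i, θ i with hhmax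
  have hθle : ∀ i, θ i ≤ hmax := fun i =>
    Finset.single_le_sum (fun i _ => (hθ0 i).le) (Finset.mem_univ i)
  have hmax0 : 0 ≤ hmax := (hθ0 0).le.trans (hθle 0)
  choose ρ' hρ' hflow using fun i => (hA i).exists_flow_bound hf (hΛ i) (le_comparisonRate i)
    (hθ0 i).le (show θ i < _ from mul_lt_of_lt_one_left (hTm i) hδ.2)
  obtain ⟨ρ, hρ, hρρ⟩ := IsClassK.exists_forall_le ρ' hρ'
  obtain ⟨αV, hαV, hαV'⟩ : ∃ αV, IsClassK αV ∧ ∀ x, V x ≤ αV ‖x‖ := by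
    obtain ⟨-, -, -, -, W, H, αW₁, αW₂, αV₁, αV₂, -, -, -, -, -, -, -, h1, -, h2, -⟩ := hA 0
    exact ⟨αV₂, h1.toIsClassK, fun x => (h2 x).2⟩
  -- per-sample decay rate `k`: every `m` samples gain the factor guaranteed by `trigger_spec`
  set k₀ := min (ε 0) εref * (δ * Tmax (γ 0) (L 0 + ε 0 / 2)) with hk₀
  have hk₀pos : 0 < k₀ := mul_pos (lt_min hε hεref) htmin
  have hmR : (0 : ℝ) < m := by exact_mod_cast hm
  set k := k₀ / m with hk
  have hkpos : 0 < k := div_pos hk₀pos hmR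
  have hkm : k * m = k₀ := div_mul_cancel₀ _ hmR.ne'
  set κ := k / (1 + hmax) with hκ
  have hκpos : 0 < κ := div_pos hkpos (by linarith)
  have hκk : κ * (1 + hmax) = k := div_mul_cancel₀ _ (by linarith)
  set M := (m : ℝ) * Real.exp (k * (m - 1)) with hM
  have hm1 : (1 : ℝ) ≤ m := by exact_mod_cast hm
  have hM1 : 1 ≤ M := one_le_mul_of_one_le_of_one_le hm1
    (Real.one_le_exp (mul_nonneg hkpos.le (by linarith)))
  have hM0 : 0 < M := by linarith
  have hρ₁ : IsClassK fun y => ρ y + M * y := hρ.add (IsClassK.const_mul hM0)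
  have hb : IsClassK fun q => Real.exp k * (αV q + q) :=
    (IsClassK.const_mul (Real.exp_pos k)).comp (hαV.add IsClassK.id)
  refine ⟨_, hρ₁.isClassKLL_comp_exp hb hκpos, ?_⟩
  intro T ξ hsol hinit t j htj
  set q := (ξ 0 0).stackedNorm with hq
  have hq0 : 0 ≤ q := Real.sqrt_nonneg _
  set B := αV q + q with hB
  have hB0 : 0 ≤ B := add_nonneg (hαV.nonneg hq0) hq0
  have hBj : ∀ j : ℕ, 0 ≤ B * Real.exp (-k * j) := fun j => mul_nonneg hB0 (Real.exp_pos _).le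
  have hΓ := fun (t : ℝ) (j : ℕ) => trigger_spec (γ := γ) (L := L) (ε := ε) hm hc hεref htmin
    (hV (ξ t j).x) (ξ t j).eta
  have hinv : ∀ (j : ℕ) (a : ℝ), IsSamplingInstant T j a →
      a ≤ j * hmax ∧ WindowBound m V k (B * Real.exp (-k * j)) (ξ a j).x (ξ a j).eta := by
    intro j
    induction j with
    | zero =>
      intro a ha
      have ha0 := hsol.eq_zero_of_mem_zero hf hinit ha.1
      subst ha0
      refine ⟨by simp, ?_⟩
      rw [Nat.cast_zero, mul_zero, Real.exp_zero, mul_one]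
      refine windowBound_of_norm_le hkpos.le hB0 ?_ ?_
      · have h1 := hαV.mono (norm_nonneg _) (ξ 0 0).norm_x_le_stackedNorm
        linarith [hαV' (ξ 0 0).x]
      · linarith [(ξ 0 0).norm_eta_le_stackedNorm, hαV.nonneg hq0]
    | succ j ih =>
      intro b hb'
      obtain ⟨a, -, ha⟩ := hsol.timeDomain.exists_jump hb'.1
      obtain ⟨hat, hwin⟩ := ih a ha
      obtain ⟨hge, i, hle, hdec⟩ := hΓ a j
      obtain ⟨hab, hxa, hea, hx, he, heta, -, heq⟩ :=
        hsol.flow_after_jump hf (htmin.le.trans hge) ha hb'.1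
      replace heq := heq hb'.2
      constructor
      · push_cast
        linarith [hθle i]
      · have hVb := (hflow i _ _ a b hx he hea (heq.le.trans hle) b ⟨hab, le_rfl⟩).1
        rw [heq, hxa] at hVb
        have hdec' := hdec _ (hwin.1.trans (le_mul_exp hm hkpos.le (hBj j)))
          fun i => (le_abs_self _).trans (hwin.abs_eta_le hkpos.le (hBj j) i)
        rw [← hk₀, ← hkm] at hdec'
        have := hwin.step hV (hVb.trans hdec')
        rw [← heta] at this
        convert this using 1
        rw [mul_assoc, ← Real.exp_add]
        push_cast
        ring_nf
  cases j with
  | zero =>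
    have ht0 := hsol.eq_zero_of_mem_zero hf hinit htj
    subst ht0
    have h1 : q ≤ Real.exp k * B := by
      have := mul_le_mul_of_nonneg_right (Real.one_le_exp hkpos.le) hB0
      linarith [hαV.nonneg hq0]
    have h2 : 0 ≤ Real.exp k * B := by positivity
    simp only [Nat.cast_zero, add_zero, mul_zero, Real.exp_zero, mul_one, ← hq]
    nlinarith [hρ.nonneg h2]
  | succ j =>
    obtain ⟨a, hat, ha⟩ := hsol.timeDomain.exists_jump htj
    obtain ⟨haj, hwin⟩ := hinv j a ha
    obtain ⟨hge, i, hle, -⟩ := hΓ a j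
    obtain ⟨hab, hxa, hea, hx, he, heta, hlen, -⟩ :=
      hsol.flow_after_jump hf (htmin.le.trans hge) ha htj
    have h1 := (hflow i _ _ a t hx he hea (hlen.trans hle) t ⟨hab, le_rfl⟩).2
    rw [hxa] at h1
    have h2 : ρ' i (V (ξ a j).x) ≤ ρ (B * Real.exp (-k * j)) :=
      (hρρ i _ (hV _)).trans (hρ.mono (hV _) hwin.1)
    have h3 := hwin.norm_etaUpdate_le hm hkpos.le (hBj j) hV
    rw [← heta] at h3
    have h4 := (ξ t (j + 1)).stackedNorm_le
    have h5 : (ξ t (j + 1)).stackedNorm ≤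
        ρ (B * Real.exp (-k * j)) + M * (B * Real.exp (-k * j)) := by
      have : (m : ℝ) * (B * Real.exp (-k * j) * Real.exp (k * (m - 1))) =
        M * (B * Real.exp (-k * j)) := by rw [hM]; ring
      linarith
    refine h5.trans (hρ₁.mono (hBj j) ?_)
    -- `t ≤ (j + 1) * hmax` converts decay in the number of samples into decay in `t + j`
    have h6 : t ≤ (j + 1) * hmax := by linarith [hθle i]
    rw [mul_comm (Real.exp k), mul_assoc, ← Real.exp_add]
    refine mul_le_mul_of_nonneg_left (Real.exp_le_exp.2 ?_) hB0
    push_cast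
    rw [← hκk]
    nlinarith

end Stability

end DynamicSTC

theorem mainTheorem3
    -- plant and controller, with continuous closed-loop vector field
    (np nc nu : ℕ)
    (fp : EuclideanSpace ℝ (Fin np) → EuclideanSpace ℝ (Fin nu) → EuclideanSpace ℝ (Fin np))
    (fc : EuclideanSpace ℝ (Fin nc) → EuclideanSpace ℝ (Fin np) → EuclideanSpace ℝ (Fin nc))
    (gc : EuclideanSpace ℝ (Fin nc) → EuclideanSpace ℝ (Fin np) → EuclideanSpace ℝ (Fin nu))
    (hf : Continuous (fun p : DynamicSTC.Vec np nc × DynamicSTC.Vec np nc =>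
      DynamicSTC.closedLoop fp fc gc p.1 p.2))
    -- Lyapunov function and parameter sets (index 0 is the fall-back set)
    (V : DynamicSTC.Vec np nc → ℝ) (N : ℕ) (ε γ L : Fin (N + 1) → ℝ)
    (hA : ∀ i, DynamicSTC.LyapunovAssumption (DynamicSTC.closedLoop fp fc gc) V (ε i) (γ i) (L i))
    (hε : 0 < ε 0)
    -- design parameters, with level `c ∈ (0, ∞]` such that `{x | V x ≤ c}` is the whole space
    (m : ℕ) (hm : 0 < m) (c : EReal) (hc : 0 < c)
    (hR : {x : DynamicSTC.Vec np nc | (V x : EReal) ≤ c} = Set.univ)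
    (δ : ℝ) (hδ : δ ∈ Set.Ioo (0 : ℝ) 1) (εref : ℝ) (hεref : 0 < εref) :
    0 < δ * DynamicSTC.Tmax (γ 0) (L 0 + ε 0 / 2) ∧
    (∀ (T : Set (ℝ × ℕ)) (ξ : ℝ → ℕ → DynamicSTC.State np nc (m - 1)),
      DynamicSTC.IsSolution
        (DynamicSTC.stcSystem (DynamicSTC.closedLoop fp fc gc) (DynamicSTC.etaUpdate m V)
          (DynamicSTC.trigger m V c δ εref ε γ L)) T ξ →
      DynamicSTC.IsInitial Set.univ (ξ 0 0) →
      ∀ (j : ℕ) (t t' : ℝ), DynamicSTC.IsSamplingInstant T j t →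
        DynamicSTC.IsSamplingInstant T (j + 1) t' →
        δ * DynamicSTC.Tmax (γ 0) (L 0 + ε 0 / 2) ≤ t' - t) ∧
    DynamicSTC.IsUGAS
      (DynamicSTC.stcSystem (DynamicSTC.closedLoop fp fc gc) (DynamicSTC.etaUpdate m V)
        (DynamicSTC.trigger m V c δ εref ε γ L)) := by
  have htmin : 0 < δ * DynamicSTC.Tmax (γ 0) (L 0 + ε 0 / 2) :=
    mul_pos hδ.1 (DynamicSTC.Tmax_pos (hA 0).2.1 (by linarith [(hA 0).1]))
  exact ⟨htmin,
    fun T ξ hsol _ j t t' ht ht' => hsol.le_sub_of_isSamplingInstant hf hm hc hεref htmin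
      (hA 0).2.2.2.1 ht ht',
    DynamicSTC.isUGAS_stcSystem hf hA hε hm hc hδ hεref⟩
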